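/- **Setting (AODV in the process algebra AWN).** Let $\mathrm{IP}$ be a set of node identifiers and $\mathrm{DATA}$ a set of application data items. Sequence numbers are natural numbers, $0$ meaning "unknown"; $\mathrm{inc}(0)=0$ and $\mathrm{inc}(n)=n+1$ for $n\neq 0$. A *routing table* $rt$ is a set of entries $(dip,dsn,dsk,flag,hops,nhip,pre)$ (destination, sequence number, status $\mathsf{kno}/\mathsf{unk}$, validity $\mathsf{val}/\mathsf{inval}$, hop count, next hop, set of precursors) with at most one entry per destination. $\mathrm{sqn}(rt,dip)$, $\mathrm{sqnf}$, $\mathrm{dhops}$, $\mathrm{nhop}$, $\mathrm{precs}$ select components of the entry for $dip$ ($\mathrm{sqn}=0$ and $\mathrm{sqnf}=\mathsf{unk}$ if there is none, the others are then undefined); $\mathrm{vD}(rt)$ and $\mathrm{iD}(rt)$ are the sets of destinations of valid and of invalid entries. * $\mathrm{addpreRT}(rt,dip,X)$ adds $X$ to the precursors of the entry for $dip$ (undefined if there is none). * $\mathrm{update}(rt,r)$ is defined for entries $r$ with $flag=\mathsf{val}$, $dsn=0\Leftrightarrow dsk=\mathsf{unk}$, and $dsk=\mathsf{unk}\Rightarrow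 hops=1$. It inserts $r$ if $rt$ has no entry $s$ for the destination of $r$. Otherwise $s$ is replaced by $r$ if $dsn_s<dsn_r$, or $dsn_s=dsn_r$ and ($hops_s>hops_r$ or $flag_s=\mathsf{inval}$); else, if $dsk_r=\mathsf{unk}$, by $r$ with sequence number $dsn_s$; else $s$ is kept. In all these cases the precursor sets of $r$ and $s$ are united. * $\mathrm{invalidate}(rt,dests)$, for a partial function $dests:\mathrm{IP}\rightharpoonup\mathbb N$, sets each entry whose destination $rip$ lies in the domain of $dests$ to $\mathsf{inval}$, with sequence number $dests(rip)$. A *store* assigns to some destinations a flag ($\mathsf{pen}$, or $\mathsf{nonpen}$ if a route request is still required) and a queue of data; $\mathrm{qD}(store)$ is the set of these destinations; $\mathrm{add}$ appends a packet (a new queue gets flag $\mathsf{nonpen}$), $\mathrm{drop}$ removes the oldest packet (and the whole entry if the queue becomes empty), $\mathrm{unsetRRF}(store,dip)$ sets the flag of $dip$ to $\mathsf{pen}$, $\mathrm{setRRF}(store,dests)$ sets the flags of the destinations in the domain of $dests$ to $\mathsf{nonpen}$. Messages are $\mathrm{rreq}(hops,rreqid,dip,dsn,dsk,oip,osn,sip)$,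 $\mathrm{rrep}(hops,dip,dsn,oip,sip)$, $\mathrm{rerr}(dests,sip)$, $\mathrm{newpkt}(d,dip)$ and $\mathrm{pkt}(d,dip,sip)$. Each node maintains variables $ip,sn,rt,rreqs,store$ (own address, own sequence number, routing table, set of handled request identifiers $(oip,rreqid)$, store). All other variables are local: they become undefined on return to $\mathbf{AODV}$, and a call of another process keeps exactly those that it passes as arguments. Variables in a condition that are not yet defined are assigned arbitrary values that make it true. A step that would evaluate an undefined expression is blocked. Let $$E:\ rt:=\mathrm{invalidate}(rt,dests);\ store:=\mathrm{setRRF}(store,dests);\ pre:=\textstyle\bigcup\{\mathrm{precs}(rt,rip): rip\in\mathrm{dom}(dests)\};\ dests:=\{(rip,rsn)\in dests:\mathrm{precs}(rt,rip)\ne\emptyset\};\ \mathbf{groupcast}(pre,\mathrm{rerr}(dests,ip));\ \mathbf{AODV}$$ and let $L(x)$ be: $dests:=\{(rip,\mathrm{inc}(\mathrm{sqn}(rt,rip))): rip\in\mathrm{vD}(rt),\ \mathrm{nhop}(rt,rip)=\mathrm{nhop}(rt,x)\}$, then $E$. In $\mathbf{unicast}(a,m)\,.\,p\blacktriangleright q$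 one continues as $p$ if $a$ is in transmission range and as $q$ otherwise. The processes are: 1. $\mathbf{AODV}$ chooses between three alternatives. (i) Receive a message from the node's message queue. For newpkt go to $\mathbf{NEWPKT}$, for pkt to $\mathbf{PKT}$; for rreq, rrep, rerr with sender $sip$ first do $rt:=\mathrm{update}(rt,(sip,0,\mathsf{unk},\mathsf{val},1,sip,\emptyset))$ and then go to $\mathbf{RREQ}$, $\mathbf{RREP}$, $\mathbf{RERR}$. (ii) For some $dip\in\mathrm{qD}(store)\cap\mathrm{vD}(rt)$, with $d$ the oldest packet queued for $dip$: $\mathbf{unicast}(\mathrm{nhop}(rt,dip),\mathrm{pkt}(d,dip,ip))\,.\,store:=\mathrm{drop}(dip,store);\mathbf{AODV}\blacktriangleright L(dip)$. (iii) For some $dip\in\mathrm{qD}(store)\setminus\mathrm{vD}(rt)$ with flag $\mathsf{nonpen}$: $store:=\mathrm{unsetRRF}(store,dip)$; $sn:=\mathrm{inc}(sn)$; $rreqid:=\max\{n:(ip,n)\in rreqs\}+1$ (with $\max\emptyset=0$); $rreqs:=rreqs\cup\{(ip,rreqid)\}$; $\mathbf{broadcast}(\mathrm{rreq}(0,rreqid,dip,\mathrm{sqn}(rt,dip),\mathrm{sqnf}(rt,dip),ip,sn,ip))$;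 $\mathbf{AODV}$. 2. $\mathbf{NEWPKT}(d,dip)$: if $dip=ip$ deliver $d$, otherwise $store:=\mathrm{add}(d,dip,store)$; then $\mathbf{AODV}$. 3. $\mathbf{PKT}(d,dip,oip)$: if $dip=ip$, deliver $d$ and go to $\mathbf{AODV}$. Otherwise, if $dip\in\mathrm{vD}(rt)$: $\mathbf{unicast}(\mathrm{nhop}(rt,dip),\mathrm{pkt}(d,dip,oip))\,.\,\mathbf{AODV}\blacktriangleright L(dip)$; if $dip\in\mathrm{iD}(rt)$: $\mathbf{groupcast}(\mathrm{precs}(rt,dip),\mathrm{rerr}(\{(dip,\mathrm{sqn}(rt,dip))\},ip))$, then $\mathbf{AODV}$; else $\mathbf{AODV}$. 4. $\mathbf{RREQ}(hops,rreqid,dip,dsn,dsk,oip,osn,sip)$: if $(oip,rreqid)\in rreqs$ go to $\mathbf{AODV}$. Otherwise $rt:=\mathrm{update}(rt,(oip,osn,\mathsf{kno},\mathsf{val},hops+1,sip,\emptyset))$; $rreqs:=rreqs\cup\{(oip,rreqid)\}$; then * if $dip=ip$: $sn:=\max(sn,dsn)$; $\mathbf{unicast}(\mathrm{nhop}(rt,oip),\mathrm{rrep}(0,dip,sn,oip,ip))\,.\,\mathbf{AODV}\blacktriangleright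 L(oip)$; * if $dip\ne ip$, $dip\in\mathrm{vD}(rt)$, $dsn\le\mathrm{sqn}(rt,dip)$ and $\mathrm{sqnf}(rt,dip)=\mathsf{kno}$: $rt:=\mathrm{addpreRT}(rt,dip,\{sip\})$; $rt:=\mathrm{addpreRT}(rt,oip,\{\mathrm{nhop}(rt,dip)\})$; $\mathbf{unicast}(\mathrm{nhop}(rt,oip),\mathrm{rrep}(\mathrm{dhops}(rt,dip),dip,\mathrm{sqn}(rt,dip),oip,ip))\,.\,\mathbf{AODV}\blacktriangleright L(oip)$; * otherwise: $\mathbf{broadcast}(\mathrm{rreq}(hops+1,rreqid,dip,\max(\mathrm{sqn}(rt,dip),dsn),dsk,oip,osn,ip))$; $\mathbf{AODV}$. 5. $\mathbf{RREP}(hops,dip,dsn,oip,sip)$: let $rt'=\mathrm{update}(rt,(dip,dsn,\mathsf{kno},\mathsf{val},hops+1,sip,\emptyset))$. If $rt'=rt$ go to $\mathbf{AODV}$. Otherwise $rt:=rt'$; if $oip=ip$ or $oip\notin\mathrm{vD}(rt)$ go to $\mathbf{AODV}$; else $rt:=\mathrm{addpreRT}(rt,dip,\{\mathrm{nhop}(rt,oip)\})$;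 $rt:=\mathrm{addpreRT}(rt,\mathrm{nhop}(rt,dip),\{\mathrm{nhop}(rt,oip)\})$; $\mathbf{unicast}(\mathrm{nhop}(rt,oip),\mathrm{rrep}(hops+1,dip,dsn,oip,ip))\,.\,\mathbf{AODV}\blacktriangleright L(oip)$. 6. $\mathbf{RERR}(dests,sip)$: $dests:=\{(rip,rsn)\in dests: rip\in\mathrm{vD}(rt),\ \mathrm{nhop}(rt,rip)=sip,\ \mathrm{sqn}(rt,rip)<rsn\}$; then $E$. 7. $\mathbf{QMSG}$, in parallel with the above on the same node, is a first-in-first-out queue that can always receive a message arriving at the node and passes its oldest message to $\mathbf{AODV}$ when $\mathbf{AODV}$ is ready to receive. Routing table entries never expire. A *network* is a finite, non-empty parallel composition of nodes with pairwise different addresses, each with a set $R\subseteq\mathrm{IP}$ of identifiers in transmission range. Initially $sn=1$, $rt=rreqs=store=\emptyset$, all queues are empty, each node knows its own address $ip$, and the sets $R$ are arbitrary. A transition of the network is an internal step of a node, a transmission, the delivery of data to an application, the injection of a message $\mathrm{newpkt}(d,dip)$ at one node by its application layer, or the appearance or disappearance of a link between two nodes (which changes the sets $R$). A broadcast, groupcast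 to $X$, or successful unicast to $a$ by a node with range $R$ is received by exactly the other nodes of the network with address in $R$, $R\cap X$, $\{a\}$, respectively. Nodes receive no messages other than those transmitted by other nodes of the network and injected messages $\mathrm{newpkt}$. A network state is *reachable* if it arises from an initial one by finitely many transitions. For a network state $N$ and $dip\in\mathrm{IP}$, the *routing graph* $\mathcal R_N(dip)$ is the directed graph with an arc from a node $ip$ of the network to $ip'$ if and only if $ip\neq dip$ and the routing table of $ip$ in $N$ contains a valid entry for $dip$ with next hop $ip'$, that is, an entry $(dip,*,*,\mathsf{val},*,ip',*)$. **Theorem.** This specification of AODV is loop free: for every reachable network state $N$ and every destination $dip\in\mathrm{IP}$, the routing graph $\mathcal R_N(dip)$ contains no directed cycle. -/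

import Mathlib

/-! ## AWN: sequential processes, parallel processes, nodes, networks -/

namespace AWN

universe u v w x y

/-- Sequential process expressions of AWN over node identifiers `IP`, application layer data `D`,
messages `M`, valuations `V` and process names `X`.  A data expression of type `τ` is a function
`V → Option τ`; the value `none` means that the expression is undefined under the valuation. -/
inductive Proc (IP : Type u) (D : Type v) (M : Type w) (V : Type x) (X : Type y) :
    Type (max u v w x y)
  /-- `X(exp₁,…,expₙ)`; `f ξ` is the valuation that is defined on the parameters of `X` only and
  assigns to them the values of the argument expressions under `ξ`. -/
  | call (name : X) (f : V → Option V)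
  /-- `p + q` -/
  | choice (p q : Proc IP D M V X)
  /-- `[φ] p`; `φ ξ ζ` says that `ζ` extends `ξ` by values for the free variables of `φ` that are
  not yet defined under `ξ`, such that the formula holds under `ζ`. -/
  | check (φ : V → V → Prop) (p : Proc IP D M V X)
  /-- `⟦var := exp⟧ p`; `f ξ` is the updated valuation, or `none` if `exp` is undefined. -/
  | assign (f : V → Option V) (p : Proc IP D M V X)
  /-- `broadcast(ms).p` -/
  | broadcast (ms : V → Option M) (p : Proc IP D M V X)
  /-- `groupcast(dests, ms).p` -/
  | groupcast (dests : V → Option (Set IP)) (ms : V → Option M) (p : Proc IP D M V X)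
  /-- `unicast(dest, ms).p ▸ q` -/
  | unicast (dest : V → Option IP) (ms : V → Option M) (p q : Proc IP D M V X)
  /-- `send(ms).p` -/
  | send (ms : V → Option M) (p : Proc IP D M V X)
  /-- `deliver(data).p` -/
  | deliver (data : V → Option D) (p : Proc IP D M V X)
  /-- `receive(msg).p`; `upd m ξ` is `ξ[msg := m]`. -/
  | receive (upd : M → V → V) (p : Proc IP D M V X)

/-- Actions of sequential and parallel processes. -/
inductive Act (IP : Type u) (D : Type v) (M : Type w) : Type (max u v w)
  | broadcast (m : M)
  | groupcast (dests : Set IP) (m : M)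
  | unicast (dest : IP) (m : M)
  | notUnicast (dest : IP) (m : M)
  | send (m : M)
  | deliver (d : D)
  | receive (m : M)
  | tau

/-- Operational semantics of sequential processes, for defining equations `Γ`.
A step that has to evaluate an undefined expression is blocked. -/
inductive SeqStep {IP : Type u} {D : Type v} {M : Type w} {V : Type x} {X : Type y}
    (Γ : X → Proc IP D M V X) :
    V × Proc IP D M V X → Act IP D M → V × Proc IP D M V X → Prop
  | call {ξ ξ' : V} {name : X} {f : V → Option V} {a : Act IP D M} {s : V × Proc IP D M V X} :
      f ξ = some ξ' → SeqStep Γ (ξ', Γ name) a s → SeqStep Γ (ξ, .call name f) a s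
  | choiceLeft {ξ : V} {p q : Proc IP D M V X} {a : Act IP D M} {s : V × Proc IP D M V X} :
      SeqStep Γ (ξ, p) a s → SeqStep Γ (ξ, .choice p q) a s
  | choiceRight {ξ : V} {p q : Proc IP D M V X} {a : Act IP D M} {s : V × Proc IP D M V X} :
      SeqStep Γ (ξ, q) a s → SeqStep Γ (ξ, .choice p q) a s
  | check {ξ ζ : V} {φ : V → V → Prop} {p : Proc IP D M V X} :
      φ ξ ζ → SeqStep Γ (ξ, .check φ p) .tau (ζ, p)
  | assign {ξ ξ' : V} {f : V → Option V} {p : Proc IP D M V X} :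
      f ξ = some ξ' → SeqStep Γ (ξ, .assign f p) .tau (ξ', p)
  | broadcast {ξ : V} {ms : V → Option M} {p : Proc IP D M V X} {m : M} :
      ms ξ = some m → SeqStep Γ (ξ, .broadcast ms p) (.broadcast m) (ξ, p)
  | groupcast {ξ : V} {dests : V → Option (Set IP)} {ms : V → Option M} {p : Proc IP D M V X}
      {ds : Set IP} {m : M} :
      dests ξ = some ds → ms ξ = some m →
        SeqStep Γ (ξ, .groupcast dests ms p) (.groupcast ds m) (ξ, p)
  | unicastSuccess {ξ : V} {dest : V → Option IP} {ms : V → Option M} {p q : Proc IP D M V X}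
      {d : IP} {m : M} :
      dest ξ = some d → ms ξ = some m →
        SeqStep Γ (ξ, .unicast dest ms p q) (.unicast d m) (ξ, p)
  | unicastFailure {ξ : V} {dest : V → Option IP} {ms : V → Option M} {p q : Proc IP D M V X}
      {d : IP} {m : M} :
      dest ξ = some d → ms ξ = some m →
        SeqStep Γ (ξ, .unicast dest ms p q) (.notUnicast d m) (ξ, q)
  | send {ξ : V} {ms : V → Option M} {p : Proc IP D M V X} {m : M} :
      ms ξ = some m → SeqStep Γ (ξ, .send ms p) (.send m) (ξ, p)
  | deliver {ξ : V} {data : V → Option D} {p : Proc IP D M V X} {d : D} :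
      data ξ = some d → SeqStep Γ (ξ, .deliver data p) (.deliver d) (ξ, p)
  | receive {ξ : V} {upd : M → V → V} {p : Proc IP D M V X} (m : M) :
      SeqStep Γ (ξ, .receive upd p) (.receive m) (upd m ξ, p)

/-- Parallel composition `P ⟨⟨ Q` of two processes on one node; messages are piped from `Q` (which
sends them) to `P` (which receives them). -/
inductive ParStep {IP : Type u} {D : Type v} {M : Type w} {S : Type x} {T : Type y}
    (trP : S → Act IP D M → S → Prop) (trQ : T → Act IP D M → T → Prop) :
    S × T → Act IP D M → S × T → Prop
  | left {P P' : S} {Q : T} {a : Act IP D M} :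
      trP P a P' → (∀ m, a ≠ .receive m) → ParStep trP trQ (P, Q) a (P', Q)
  | right {P : S} {Q Q' : T} {a : Act IP D M} :
      trQ Q a Q' → (∀ m, a ≠ .send m) → ParStep trP trQ (P, Q) a (P, Q')
  | sync {P P' : S} {Q Q' : T} (m : M) :
      trP P (.receive m) P' → trQ Q (.send m) Q' → ParStep trP trQ (P, Q) .tau (P', Q')

/-- Partial networks: parallel compositions of node expressions `a : P : R`, where `a` is the
address, `P` the (state of the) process and `R` the transmission range. -/
inductive Net (IP : Type u) (S : Type x) : Type (max u x)
  | node (a : IP) (P : S) (R : Set IP)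
  | par (M N : Net IP S)

/-- The list of the nodes (address, process, range) of a network. -/
def Net.nodes {IP : Type u} {S : Type x} : Net IP S → List (IP × S × Set IP)
  | .node a P R => [(a, P, R)]
  | .par M N => M.nodes ++ N.nodes

/-- Actions of partial networks. -/
inductive NetAct (IP : Type u) (D : Type v) (M : Type w) : Type (max u v w)
  /-- `R:*cast(m)`: the message `m` is transmitted to the nodes in `R`. -/
  | cast (R : Set IP) (m : M)
  /-- `H¬K:arrive(m)`: `m` arrives at the nodes in `H` and does not arrive at those in `K`. -/
  | arrive (H K : Set IP) (m : M)
  | deliver (a : IP) (d : D)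
  | connect (a b : IP)
  | disconnect (a b : IP)
  | tau

/-- Operational semantics of node expressions and of their parallel compositions. -/
inductive NetStep {IP : Type u} {D : Type v} {M : Type w} {S : Type x}
    (tr : S → Act IP D M → S → Prop) : Net IP S → NetAct IP D M → Net IP S → Prop
  | broadcast {a : IP} {P P' : S} {R : Set IP} {m : M} :
      tr P (.broadcast m) P' → NetStep tr (.node a P R) (.cast R m) (.node a P' R)
  | groupcast {a : IP} {P P' : S} {R ds : Set IP} {m : M} :
      tr P (.groupcast ds m) P' → NetStep tr (.node a P R) (.cast (R ∩ ds) m) (.node a P' R)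
  | unicast {a : IP} {P P' : S} {R : Set IP} {d : IP} {m : M} :
      tr P (.unicast d m) P' → d ∈ R → NetStep tr (.node a P R) (.cast {d} m) (.node a P' R)
  | notUnicast {a : IP} {P P' : S} {R : Set IP} {d : IP} {m : M} :
      tr P (.notUnicast d m) P' → d ∉ R → NetStep tr (.node a P R) .tau (.node a P' R)
  | deliver {a : IP} {P P' : S} {R : Set IP} {d : D} :
      tr P (.deliver d) P' → NetStep tr (.node a P R) (.deliver a d) (.node a P' R)
  | tau {a : IP} {P P' : S} {R : Set IP} :
      tr P .tau P' → NetStep tr (.node a P R) .tau (.node a P' R)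
  | receive {a : IP} {P P' : S} {R : Set IP} {m : M} :
      tr P (.receive m) P' → NetStep tr (.node a P R) (.arrive {a} ∅ m) (.node a P' R)
  | ignore {a : IP} {P : S} {R : Set IP} (m : M) :
      NetStep tr (.node a P R) (.arrive ∅ {a} m) (.node a P R)
  | connectFrom {a : IP} {P : S} {R : Set IP} (b : IP) :
      NetStep tr (.node a P R) (.connect a b) (.node a P (R ∪ {b}))
  | connectTo {a : IP} {P : S} {R : Set IP} (b : IP) :
      NetStep tr (.node a P R) (.connect b a) (.node a P (R ∪ {b}))
  | connectOther {a : IP} {P : S} {R : Set IP} (b c : IP) :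
      a ≠ b → a ≠ c → NetStep tr (.node a P R) (.connect b c) (.node a P R)
  | disconnectFrom {a : IP} {P : S} {R : Set IP} (b : IP) :
      NetStep tr (.node a P R) (.disconnect a b) (.node a P (R \ {b}))
  | disconnectTo {a : IP} {P : S} {R : Set IP} (b : IP) :
      NetStep tr (.node a P R) (.disconnect b a) (.node a P (R \ {b}))
  | disconnectOther {a : IP} {P : S} {R : Set IP} (b c : IP) :
      a ≠ b → a ≠ c → NetStep tr (.node a P R) (.disconnect b c) (.node a P R)
  | castLeft {N₁ N₁' N₂ N₂' : Net IP S} {R H K : Set IP} {m : M} :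
      NetStep tr N₁ (.cast R m) N₁' → NetStep tr N₂ (.arrive H K m) N₂' →
        H ⊆ R → K ∩ R = ∅ → NetStep tr (.par N₁ N₂) (.cast R m) (.par N₁' N₂')
  | castRight {N₁ N₁' N₂ N₂' : Net IP S} {R H K : Set IP} {m : M} :
      NetStep tr N₁ (.arrive H K m) N₁' → NetStep tr N₂ (.cast R m) N₂' →
        H ⊆ R → K ∩ R = ∅ → NetStep tr (.par N₁ N₂) (.cast R m) (.par N₁' N₂')
  | arriveBoth {N₁ N₁' N₂ N₂' : Net IP S} {H K H' K' : Set IP} {m : M} :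
      NetStep tr N₁ (.arrive H K m) N₁' → NetStep tr N₂ (.arrive H' K' m) N₂' →
        NetStep tr (.par N₁ N₂) (.arrive (H ∪ H') (K ∪ K') m) (.par N₁' N₂')
  | deliverLeft {N₁ N₁' N₂ : Net IP S} {a : IP} {d : D} :
      NetStep tr N₁ (.deliver a d) N₁' → NetStep tr (.par N₁ N₂) (.deliver a d) (.par N₁' N₂)
  | deliverRight {N₁ N₂ N₂' : Net IP S} {a : IP} {d : D} :
      NetStep tr N₂ (.deliver a d) N₂' → NetStep tr (.par N₁ N₂) (.deliver a d) (.par N₁ N₂')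
  | tauLeft {N₁ N₁' N₂ : Net IP S} :
      NetStep tr N₁ .tau N₁' → NetStep tr (.par N₁ N₂) .tau (.par N₁' N₂)
  | tauRight {N₁ N₂ N₂' : Net IP S} :
      NetStep tr N₂ .tau N₂' → NetStep tr (.par N₁ N₂) .tau (.par N₁ N₂')
  | connectBoth {N₁ N₁' N₂ N₂' : Net IP S} {a b : IP} :
      NetStep tr N₁ (.connect a b) N₁' → NetStep tr N₂ (.connect a b) N₂' →
        NetStep tr (.par N₁ N₂) (.connect a b) (.par N₁' N₂')
  | disconnectBoth {N₁ N₁' N₂ N₂' : Net IP S} {a b : IP} :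
      NetStep tr N₁ (.disconnect a b) N₁' → NetStep tr N₂ (.disconnect a b) N₂' →
        NetStep tr (.par N₁ N₂) (.disconnect a b) (.par N₁' N₂')

/-- Actions of complete (encapsulated) networks. -/
inductive ClosedAct (IP : Type u) (D : Type v) : Type (max u v)
  | newpkt (a : IP) (d : D) (dip : IP)
  | deliver (a : IP) (d : D)
  | connect (a b : IP)
  | disconnect (a b : IP)
  | tau

/-- Operational semantics of encapsulated networks `[N]`: a message can only be received if it is
transmitted by a node of the network, or if it is a new packet `newpkt d dip` which the
application layer submits to a single node. -/
inductive ClosedStep {IP : Type u} {D : Type v} {M : Type w} {S : Type x}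
    (newpkt : D → IP → M) (tr : S → Act IP D M → S → Prop) :
    Net IP S → ClosedAct IP D → Net IP S → Prop
  | cast {N N' : Net IP S} {R : Set IP} {m : M} :
      NetStep tr N (.cast R m) N' → ClosedStep newpkt tr N .tau N'
  | newpkt {N N' : Net IP S} {a : IP} {K : Set IP} {d : D} {dip : IP} :
      NetStep tr N (.arrive {a} K (newpkt d dip)) N' →
        ClosedStep newpkt tr N (.newpkt a d dip) N'
  | deliver {N N' : Net IP S} {a : IP} {d : D} :
      NetStep tr N (.deliver a d) N' → ClosedStep newpkt tr N (.deliver a d) N'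
  | connect {N N' : Net IP S} {a b : IP} :
      NetStep tr N (.connect a b) N' → ClosedStep newpkt tr N (.connect a b) N'
  | disconnect {N N' : Net IP S} {a b : IP} :
      NetStep tr N (.disconnect a b) N' → ClosedStep newpkt tr N (.disconnect a b) N'
  | tau {N N' : Net IP S} :
      NetStep tr N .tau N' → ClosedStep newpkt tr N .tau N'

end AWN

/-! ## AODV -/

namespace AODV

universe u v

/-! ### Data structure -/

/-- Sequence numbers; `0` stands for the unknown sequence number. -/
abbrev SQN : Type := ℕ

/-- Sequence-number-status flag: known or unknown. -/
inductive SQNK : Type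
  | kno
  | unk

/-- Route validity. -/
inductive Flag : Type
  | val
  | inval

/-- Flag of a data queue: `nonpen` if a route request still has to be sent, `pen` if not. -/
inductive PendingRREQ : Type
  | pen
  | nonpen

/-- Increment of sequence numbers. -/
def inc (sn : SQN) : SQN := if sn ≠ 0 then sn + 1 else sn

/-- The six components of a routing table entry next to its destination. -/
structure Entry (IP : Type u) : Type u where
  /-- destination sequence number -/
  dsn : SQN
  /-- sequence-number-status flag -/
  dsk : SQNK
  /-- validity -/
  flag : Flag
  /-- hop count -/
  hops : ℕ
  /-- next hop -/
  nhip : IP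
  /-- precursors -/
  pre : Set IP

/-- Routing tables: finite or infinite sets of entries with at most one entry per destination, that
is, partial functions from destinations to entries. -/
abbrev RT (IP : Type u) : Type u := IP → Option (Entry IP)

section RoutingTables

variable {IP : Type u}

def sqn (rt : RT IP) (dip : IP) : SQN := (rt dip).elim 0 Entry.dsn

def sqnf (rt : RT IP) (dip : IP) : SQNK := (rt dip).elim .unk Entry.dsk

def dhops (rt : RT IP) (dip : IP) : Option ℕ := (rt dip).map Entry.hops

def nhop (rt : RT IP) (dip : IP) : Option IP := (rt dip).map Entry.nhip

def precs (rt : RT IP) (dip : IP) : Option (Set IP) := (rt dip).map Entry.pre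

/-- The destinations of valid entries. -/
def vD (rt : RT IP) : Set IP := {dip | ∃ e, rt dip = some e ∧ e.flag = .val}

/-- The destinations of invalid entries. -/
def iD (rt : RT IP) : Set IP := {dip | ∃ e, rt dip = some e ∧ e.flag = .inval}

def addpre (e : Entry IP) (npre : Set IP) : Entry IP := { e with pre := e.pre ∪ npre }

open scoped Classical in
/-- Add precursors to the entry for `dip`; undefined if there is no such entry. -/
noncomputable def addpreRT (rt : RT IP) (dip : IP) (npre : Set IP) : Option (RT IP) :=
  (rt dip).map fun e => Function.update rt dip (some (addpre e npre))

open scoped Classical in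
/-- Update of a routing table with a new entry `r` for the destination `dip`. -/
noncomputable def update (rt : RT IP) (dip : IP) (r : Entry IP) : Option (RT IP) :=
  if r.flag = .val ∧ (r.dsn = 0 ↔ r.dsk = .unk) ∧ (r.dsk = .unk → r.hops = 1) then
    match rt dip with
    | none => some (Function.update rt dip (some r))
    | some s => some (Function.update rt dip (some (
        if s.dsn < r.dsn then addpre r s.pre
        else if s.dsn = r.dsn ∧ r.hops < s.hops then addpre r s.pre
        else if s.dsn = r.dsn ∧ s.flag = .inval then addpre r s.pre
        else if r.dsk = .unk then { addpre r s.pre with dsn := s.dsn }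
        else addpre s r.pre)))
  else none

/-- Invalidate the entries for the destinations in `dests`. -/
def invalidate (rt : RT IP) (dests : IP → Option SQN) : RT IP := fun rip =>
  match rt rip, dests rip with
  | some e, some rsn => some { e with dsn := rsn, flag := .inval }
  | o, _ => o

/-- A fresh route request identifier.  The supremum of the empty set is `0`; for the (finite) sets
of identifiers that occur, the supremum is the maximum. -/
noncomputable def nrreqid (rreqs : Set (IP × ℕ)) (ip : IP) : ℕ :=
  sSup {n | (ip, n) ∈ rreqs} + 1

end RoutingTables

/-- Stores of queued data packets: at most one queue, with its flag, per destination.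
The oldest element of a queue is the head of the list. -/
abbrev Store (IP : Type u) (D : Type v) : Type (max u v) := IP → Option (PendingRREQ × List D)

section Stores

variable {IP : Type u} {D : Type v}

def selQueue (store : Store IP D) (dip : IP) : List D := (store dip).elim [] Prod.snd

/-- The destinations with unsent packets. -/
def qD (store : Store IP D) : Set IP := {dip | (store dip).isSome}

def pflag (store : Store IP D) (dip : IP) : Option PendingRREQ := (store dip).map Prod.fst

open scoped Classical in
noncomputable def add (d : D) (dip : IP) (store : Store IP D) : Store IP D :=
  match store dip with
  | none => Function.update store dip (some (.nonpen, [d]))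
  | some (p, q) => Function.update store dip (some (p, q ++ [d]))

open scoped Classical in
/-- Delete the oldest packet for `dip`; undefined if there is none. -/
noncomputable def drop (dip : IP) (store : Store IP D) : Option (Store IP D) :=
  match store dip with
  | none => none
  | some (_, []) => none
  | some (_, [_]) => some (Function.update store dip none)
  | some (p, _ :: d :: q) => some (Function.update store dip (some (p, d :: q)))

open scoped Classical in
/-- Record that a route request for `dip` has been initiated. -/
noncomputable def unsetRRF (store : Store IP D) (dip : IP) : Store IP D :=
  match store dip with
  | none => store
  | some (_, q) => Function.update store dip (some (.pen, q))

/-- Record that new route requests for the destinations in `dests` may be needed. -/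
def setRRF (store : Store IP D) (dests : IP → Option SQN) : Store IP D := fun dip =>
  match store dip, dests dip with
  | some (_, q), some _ => some (.nonpen, q)
  | o, _ => o

end Stores

/-- Messages. -/
inductive Msg (IP : Type u) (D : Type v) : Type (max u v)
  | rreq (hops rreqid : ℕ) (dip : IP) (dsn : SQN) (dsk : SQNK) (oip : IP) (osn : SQN) (sip : IP)
  | rrep (hops : ℕ) (dip : IP) (dsn : SQN) (oip sip : IP)
  | rerr (dests : IP → Option SQN) (sip : IP)
  | newpkt (d : D) (dip : IP)
  | pkt (d : D) (dip sip : IP)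

/-! ### The specification -/

/-- Valuations of the data variables of all processes but the message queue.  The first five
variables are always defined; the others are defined only within part of the code. -/
structure Val (IP : Type u) (D : Type v) : Type (max u v) where
  ip : IP
  sn : SQN
  rt : RT IP
  rreqs : Set (IP × ℕ)
  store : Store IP D
  msg : Option (Msg IP D) := none
  data : Option D := none
  dip : Option IP := none
  oip : Option IP := none
  sip : Option IP := none
  hops : Option ℕ := none
  rreqid : Option ℕ := none
  dsn : Option SQN := none
  dsk : Option SQNK := none
  osn : Option SQN := none
  dests : Option (IP → Option SQN) := none
  pre : Option (Set IP) := none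

/-- The restriction of a valuation to the five variables that are always defined. -/
def Val.base {IP : Type u} {D : Type v} (ξ : Val IP D) : Val IP D where
  ip := ξ.ip
  sn := ξ.sn
  rt := ξ.rt
  rreqs := ξ.rreqs
  store := ξ.store

/-- The names of the defined processes, except for the message queue. -/
inductive Name : Type
  | aodv
  | newpkt
  | pkt
  | rreq
  | rrep
  | rerr

section Specification

variable {IP : Type u} {D : Type v}

/-- Process expressions of AODV. -/
abbrev P (IP : Type u) (D : Type v) : Type (max u v) := AWN.Proc IP D (Msg IP D) (Val IP D) Name

open AWN.Proc

/-- A condition without free variables that are still to be assigned values. -/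
def test (b : Val IP D → Prop) : Val IP D → Val IP D → Prop := fun ξ ζ => b ξ ∧ ζ = ξ

/-- `AODV(ip, sn, rt, rreqs, store)` -/
def callAODV : P IP D := call .aodv fun ξ => some ξ.base

/-- `NEWPKT(data, dip, ip, sn, rt, rreqs, store)` -/
def callNEWPKT : P IP D := call .newpkt fun ξ =>
  ξ.data.bind fun data =>
  ξ.dip.bind fun dip =>
  some { ξ.base with data := some data, dip := some dip }

/-- `PKT(data, dip, oip, ip, sn, rt, rreqs, store)` -/
def callPKT : P IP D := call .pkt fun ξ =>
  ξ.data.bind fun data =>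
  ξ.dip.bind fun dip =>
  ξ.oip.bind fun oip =>
  some { ξ.base with data := some data, dip := some dip, oip := some oip }

/-- `RREQ(hops, rreqid, dip, dsn, dsk, oip, osn, sip, ip, sn, rt, rreqs, store)` -/
def callRREQ : P IP D := call .rreq fun ξ =>
  ξ.hops.bind fun hops =>
  ξ.rreqid.bind fun rreqid =>
  ξ.dip.bind fun dip =>
  ξ.dsn.bind fun dsn =>
  ξ.dsk.bind fun dsk =>
  ξ.oip.bind fun oip =>
  ξ.osn.bind fun osn =>
  ξ.sip.bind fun sip =>
  some { ξ.base with
    hops := some hops, rreqid := some rreqid, dip := some dip, dsn := some dsn, dsk := some dsk,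
    oip := some oip, osn := some osn, sip := some sip }

/-- `RREP(hops, dip, dsn, oip, sip, ip, sn, rt, rreqs, store)` -/
def callRREP : P IP D := call .rrep fun ξ =>
  ξ.hops.bind fun hops =>
  ξ.dip.bind fun dip =>
  ξ.dsn.bind fun dsn =>
  ξ.oip.bind fun oip =>
  ξ.sip.bind fun sip =>
  some { ξ.base with
    hops := some hops, dip := some dip, dsn := some dsn, oip := some oip, sip := some sip }

/-- `RERR(dests, sip, ip, sn, rt, rreqs, store)` -/
def callRERR : P IP D := call .rerr fun ξ =>
  ξ.dests.bind fun dests =>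
  ξ.sip.bind fun sip =>
  some { ξ.base with dests := some dests, sip := some sip }

open scoped Classical in
/-- The common end of error handling:
`⟦rt := invalidate(rt, dests)⟧ ⟦store := setRRF(store, dests)⟧`
`⟦pre := ⋃ {precs(rt, rip) | (rip, *) ∈ dests}⟧`
`⟦dests := {(rip, rsn) | (rip, rsn) ∈ dests ∧ precs(rt, rip) ≠ ∅}⟧`
`groupcast(pre, rerr(dests, ip)) . AODV(ip, sn, rt, rreqs, store)`. -/
noncomputable def invalidateAndInform : P IP D :=
  assign (fun ξ =>
    ξ.dests.bind fun dests =>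
    some { ξ with rt := invalidate ξ.rt dests }) <|
  assign (fun ξ =>
    ξ.dests.bind fun dests =>
    some { ξ with store := setRRF ξ.store dests }) <|
  assign (fun ξ =>
    ξ.dests.bind fun dests =>
    some { ξ with
      pre := some {a | ∃ rip s, (dests rip).isSome ∧ precs ξ.rt rip = some s ∧ a ∈ s} }) <|
  assign (fun ξ =>
    ξ.dests.bind fun dests =>
    some { ξ with
      dests := some fun rip =>
        if ∃ s, precs ξ.rt rip = some s ∧ s ≠ ∅ then dests rip else none }) <|
  groupcast (fun ξ => ξ.pre) (fun ξ =>
    ξ.dests.bind fun dests =>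
    some (.rerr dests ξ.ip))
  callAODV

open scoped Classical in
/-- The reaction to an unsuccessful unicast to the next hop `nhop(rt, dst)`:
`⟦dests := {(rip, inc(sqn(rt, rip))) | rip ∈ vD(rt) ∧ nhop(rt, rip) = nhop(rt, dst)}⟧`,
followed by invalidation and an error message. -/
noncomputable def linkBreak (dst : Val IP D → Option IP) : P IP D :=
  assign (fun ξ =>
    (dst ξ).bind fun d =>
    some { ξ with
      dests := some fun rip =>
        if rip ∈ vD ξ.rt ∧ nhop ξ.rt rip = nhop ξ.rt d then some (inc (sqn ξ.rt rip))
        else none }) <|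
  invalidateAndInform

/-- `⟦rt := update(rt, (sip, 0, unk, val, 1, sip, ∅))⟧ p` -/
noncomputable def updateSender (p : P IP D) : P IP D :=
  assign (fun ξ =>
    ξ.sip.bind fun sip =>
    (update ξ.rt sip ⟨0, .unk, .val, 1, sip, ∅⟩).bind fun rt' =>
    some { ξ with rt := rt' }) p

/-- The basic routine, first part: read a message and handle it. -/
noncomputable def bodyAODVReceive : P IP D :=
  receive (fun m ξ => { ξ with msg := some m }) <|
    choice
      (check (fun ξ ζ => ∃ data dip, ξ.msg = some (.newpkt data dip) ∧
          ζ = { ξ with data := some data, dip := some dip })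
        callNEWPKT) <|
    choice
      (check (fun ξ ζ => ∃ data dip oip, ξ.msg = some (.pkt data dip oip) ∧
          ζ = { ξ with data := some data, dip := some dip, oip := some oip })
        callPKT) <|
    choice
      (check (fun ξ ζ => ∃ hops rreqid dip dsn dsk oip osn sip,
          ξ.msg = some (.rreq hops rreqid dip dsn dsk oip osn sip) ∧
          ζ = { ξ with
            hops := some hops, rreqid := some rreqid, dip := some dip, dsn := some dsn,
            dsk := some dsk, oip := some oip, osn := some osn, sip := some sip })
        (updateSender callRREQ)) <|
    choice
      (check (fun ξ ζ => ∃ hops dip dsn oip sip, ξ.msg = some (.rrep hops dip dsn oip sip) ∧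
          ζ = { ξ with
            hops := some hops, dip := some dip, dsn := some dsn, oip := some oip,
            sip := some sip })
        (updateSender callRREP))
      (check (fun ξ ζ => ∃ dests sip, ξ.msg = some (.rerr dests sip) ∧
          ζ = { ξ with dests := some dests, sip := some sip })
        (updateSender callRERR))

/-- The basic routine, second part: send a queued data packet if a valid route is known. -/
noncomputable def bodyAODVSend : P IP D :=
  check (fun ξ ζ => ∃ dip, dip ∈ qD ξ.store ∩ vD ξ.rt ∧ ζ = { ξ with dip := some dip }) <|
  assign (fun ξ =>
    ξ.dip.bind fun dip =>
    (selQueue ξ.store dip).head?.bind fun d =>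
    some { ξ with data := some d }) <|
  unicast
    (fun ξ =>
      ξ.dip.bind fun dip =>
      nhop ξ.rt dip)
    (fun ξ =>
      ξ.data.bind fun data =>
      ξ.dip.bind fun dip =>
      some (.pkt data dip ξ.ip))
    (assign (fun ξ =>
        ξ.dip.bind fun dip =>
        (drop dip ξ.store).bind fun store' =>
        some { ξ with store := store' })
      callAODV)
    (linkBreak fun ξ => ξ.dip)

/-- The basic routine, third part: initiate a route discovery. -/
noncomputable def bodyAODVRequest : P IP D :=
  check (fun ξ ζ => ∃ dip, dip ∈ qD ξ.store \ vD ξ.rt ∧ pflag ξ.store dip = some .nonpen ∧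
    ζ = { ξ with dip := some dip }) <|
  assign (fun ξ =>
    ξ.dip.bind fun dip =>
    some { ξ with store := unsetRRF ξ.store dip }) <|
  assign (fun ξ => some { ξ with sn := inc ξ.sn }) <|
  assign (fun ξ => some { ξ with rreqid := some (nrreqid ξ.rreqs ξ.ip) }) <|
  assign (fun ξ =>
    ξ.rreqid.bind fun rreqid =>
    some { ξ with rreqs := ξ.rreqs ∪ {(ξ.ip, rreqid)} }) <|
  broadcast (fun ξ =>
    ξ.rreqid.bind fun rreqid =>
    ξ.dip.bind fun dip =>
    some (.rreq 0 rreqid dip (sqn ξ.rt dip) (sqnf ξ.rt dip) ξ.ip ξ.sn ξ.ip))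
  callAODV

/-- `AODV`: the basic routine. -/
noncomputable def bodyAODV : P IP D :=
  choice bodyAODVReceive (choice bodyAODVSend bodyAODVRequest)

/-- `NEWPKT`: handling a newly injected data packet. -/
noncomputable def bodyNEWPKT : P IP D :=
  choice
    (check (test fun ξ => ξ.dip = some ξ.ip) <|
      deliver (fun ξ => ξ.data) callAODV)
    (check (test fun ξ => ∃ dip, ξ.dip = some dip ∧ dip ≠ ξ.ip) <|
      assign (fun ξ =>
        ξ.data.bind fun data =>
        ξ.dip.bind fun dip =>
        some { ξ with store := add data dip ξ.store })
      callAODV)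

open scoped Classical in
/-- `PKT`: handling a received data packet. -/
noncomputable def bodyPKT : P IP D :=
  choice
    (check (test fun ξ => ξ.dip = some ξ.ip) <|
      deliver (fun ξ => ξ.data) callAODV)
    (check (test fun ξ => ∃ dip, ξ.dip = some dip ∧ dip ≠ ξ.ip) <|
      choice
        (check (test fun ξ => ∃ dip, ξ.dip = some dip ∧ dip ∈ vD ξ.rt) <|
          unicast
            (fun ξ =>
              ξ.dip.bind fun dip =>
              nhop ξ.rt dip)
            (fun ξ =>
              ξ.data.bind fun data =>
              ξ.dip.bind fun dip =>
              ξ.oip.bind fun oip =>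
              some (.pkt data dip oip))
            callAODV
            (linkBreak fun ξ => ξ.dip))
        (check (test fun ξ => ∃ dip, ξ.dip = some dip ∧ dip ∉ vD ξ.rt) <|
          choice
            (check (test fun ξ => ∃ dip, ξ.dip = some dip ∧ dip ∈ iD ξ.rt) <|
              groupcast
                (fun ξ =>
                  ξ.dip.bind fun dip =>
                  precs ξ.rt dip)
                (fun ξ =>
                  ξ.dip.bind fun dip =>
                  some (.rerr (fun rip => if rip = dip then some (sqn ξ.rt dip) else none) ξ.ip))
                callAODV)
            (check (test fun ξ => ∃ dip, ξ.dip = some dip ∧ dip ∉ iD ξ.rt) callAODV)))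

/-- `RREQ`: handling a route request. -/
noncomputable def bodyRREQ : P IP D :=
  choice
    (check (test fun ξ => ∃ oip rreqid, ξ.oip = some oip ∧ ξ.rreqid = some rreqid ∧
        (oip, rreqid) ∈ ξ.rreqs)
      callAODV)
    (check (test fun ξ => ∃ oip rreqid, ξ.oip = some oip ∧ ξ.rreqid = some rreqid ∧
        (oip, rreqid) ∉ ξ.rreqs) <|
      assign (fun ξ =>
        ξ.oip.bind fun oip =>
        ξ.osn.bind fun osn =>
        ξ.hops.bind fun hops =>
        ξ.sip.bind fun sip =>
        (update ξ.rt oip ⟨osn, .kno, .val, hops + 1, sip, ∅⟩).bind fun rt' =>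
        some { ξ with rt := rt' }) <|
      assign (fun ξ =>
        ξ.oip.bind fun oip =>
        ξ.rreqid.bind fun rreqid =>
        some { ξ with rreqs := ξ.rreqs ∪ {(oip, rreqid)} }) <|
      choice
        -- this node is the destination node
        (check (test fun ξ => ξ.dip = some ξ.ip) <|
          assign (fun ξ =>
            ξ.dsn.bind fun dsn =>
            some { ξ with sn := max ξ.sn dsn }) <|
          unicast
            (fun ξ =>
              ξ.oip.bind fun oip =>
              nhop ξ.rt oip)
            (fun ξ =>
              ξ.dip.bind fun dip =>
              ξ.oip.bind fun oip =>
              some (.rrep 0 dip ξ.sn oip ξ.ip))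
            callAODV
            (linkBreak fun ξ => ξ.oip))
        -- this node is not the destination node
        (check (test fun ξ => ∃ dip, ξ.dip = some dip ∧ dip ≠ ξ.ip) <|
          choice
            -- there is a valid route to `dip` that is fresh enough
            (check (test fun ξ => ∃ dip dsn, ξ.dip = some dip ∧ ξ.dsn = some dsn ∧
                dip ∈ vD ξ.rt ∧ dsn ≤ sqn ξ.rt dip ∧ sqnf ξ.rt dip = .kno) <|
              assign (fun ξ =>
                ξ.dip.bind fun dip =>
                ξ.sip.bind fun sip =>
                (addpreRT ξ.rt dip {sip}).bind fun rt' =>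
                some { ξ with rt := rt' }) <|
              assign (fun ξ =>
                ξ.oip.bind fun oip =>
                ξ.dip.bind fun dip =>
                (nhop ξ.rt dip).bind fun nh =>
                (addpreRT ξ.rt oip {nh}).bind fun rt' =>
                some { ξ with rt := rt' }) <|
              unicast
                (fun ξ =>
                  ξ.oip.bind fun oip =>
                  nhop ξ.rt oip)
                (fun ξ =>
                  ξ.dip.bind fun dip =>
                  ξ.oip.bind fun oip =>
                  (dhops ξ.rt dip).bind fun h =>
                  some (.rrep h dip (sqn ξ.rt dip) oip ξ.ip))
                callAODV
                (linkBreak fun ξ => ξ.oip))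
            -- there is no such route: forward the route request
            (check (test fun ξ => ∃ dip dsn, ξ.dip = some dip ∧ ξ.dsn = some dsn ∧
                (dip ∉ vD ξ.rt ∨ sqn ξ.rt dip < dsn ∨ sqnf ξ.rt dip = .unk)) <|
              broadcast
                (fun ξ =>
                  ξ.hops.bind fun hops =>
                  ξ.rreqid.bind fun rreqid =>
                  ξ.dip.bind fun dip =>
                  ξ.dsn.bind fun dsn =>
                  ξ.dsk.bind fun dsk =>
                  ξ.oip.bind fun oip =>
                  ξ.osn.bind fun osn =>
                  some (.rreq (hops + 1) rreqid dip (max (sqn ξ.rt dip) dsn) dsk oip osn ξ.ip))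
                callAODV)))

/-- The value of `update(rt, (dip, dsn, kno, val, hops + 1, sip, ∅))`. -/
noncomputable def forwardUpdate (ξ : Val IP D) : Option (RT IP) :=
  ξ.dip.bind fun dip =>
  ξ.dsn.bind fun dsn =>
  ξ.hops.bind fun hops =>
  ξ.sip.bind fun sip =>
  update ξ.rt dip ⟨dsn, .kno, .val, hops + 1, sip, ∅⟩

/-- `RREP`: handling a route reply. -/
noncomputable def bodyRREP : P IP D :=
  choice
    -- the routing table has to be updated
    (check (test fun ξ => ∃ rt', forwardUpdate ξ = some rt' ∧ ξ.rt ≠ rt') <|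
      assign (fun ξ =>
        (forwardUpdate ξ).bind fun rt' =>
        some { ξ with rt := rt' }) <|
      choice
        (check (test fun ξ => ξ.oip = some ξ.ip) callAODV)
        (check (test fun ξ => ∃ oip, ξ.oip = some oip ∧ oip ≠ ξ.ip) <|
          choice
            (check (test fun ξ => ∃ oip, ξ.oip = some oip ∧ oip ∈ vD ξ.rt) <|
              assign (fun ξ =>
                ξ.dip.bind fun dip =>
                ξ.oip.bind fun oip =>
                (nhop ξ.rt oip).bind fun nh =>
                (addpreRT ξ.rt dip {nh}).bind fun rt' =>
                some { ξ with rt := rt' }) <|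
              assign (fun ξ =>
                ξ.dip.bind fun dip =>
                ξ.oip.bind fun oip =>
                (nhop ξ.rt dip).bind fun nhd =>
                (nhop ξ.rt oip).bind fun nho =>
                (addpreRT ξ.rt nhd {nho}).bind fun rt' =>
                some { ξ with rt := rt' }) <|
              unicast
                (fun ξ =>
                  ξ.oip.bind fun oip =>
                  nhop ξ.rt oip)
                (fun ξ =>
                  ξ.hops.bind fun hops =>
                  ξ.dip.bind fun dip =>
                  ξ.dsn.bind fun dsn =>
                  ξ.oip.bind fun oip =>
                  some (.rrep (hops + 1) dip dsn oip ξ.ip))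
                callAODV
                (linkBreak fun ξ => ξ.oip))
            (check (test fun ξ => ∃ oip, ξ.oip = some oip ∧ oip ∉ vD ξ.rt) callAODV)))
    -- the routing table is not updated
    (check (test fun ξ => ∃ rt', forwardUpdate ξ = some rt' ∧ ξ.rt = rt') callAODV)

open scoped Classical in
/-- `RERR`: handling a route error message; it starts with
`⟦dests := {(rip, rsn) | (rip, rsn) ∈ dests ∧ rip ∈ vD(rt) ∧ nhop(rt, rip) = sip ∧`
`sqn(rt, rip) < rsn}⟧`. -/
noncomputable def bodyRERR : P IP D :=
  assign (fun ξ =>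
    ξ.dests.bind fun dests =>
    ξ.sip.bind fun sip =>
    some { ξ with
      dests := some fun rip =>
        if ∃ rsn, dests rip = some rsn ∧ rip ∈ vD ξ.rt ∧ nhop ξ.rt rip = some sip ∧
          sqn ξ.rt rip < rsn
        then dests rip else none }) <|
  invalidateAndInform

/-- The defining equations of the process names. -/
noncomputable def Γ : Name → P IP D
  | .aodv => bodyAODV
  | .newpkt => bodyNEWPKT
  | .pkt => bodyPKT
  | .rreq => bodyRREQ
  | .rrep => bodyRREP
  | .rerr => bodyRERR

/-- Valuations of the variables of the message queue. -/
structure QVal (IP : Type u) (D : Type v) : Type (max u v) where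
  msgs : List (Msg IP D)
  msg : Option (Msg IP D) := none

/-- Process expressions of the message queue, which has a single process name. -/
abbrev QP (IP : Type u) (D : Type v) : Type (max u v) :=
  AWN.Proc IP D (Msg IP D) (QVal IP D) Unit

/-- `receive(msg) . QMSG(append(msg, msgs))` -/
def queueReceive : QP IP D :=
  receive (fun m ζ => { ζ with msg := some m }) <|
  call () fun ζ =>
    ζ.msg.bind fun m =>
    some { msgs := ζ.msgs ++ [m] }

/-- `QMSG`: the message queue; the oldest message is the head of the list. -/
def bodyQMSG : QP IP D :=
  choice queueReceive <|
    check (fun ζ ζ' => ζ.msgs ≠ [] ∧ ζ' = ζ) <|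
      choice
        (send (fun ζ => ζ.msgs.head?) <|
          call () fun ζ => if ζ.msgs = [] then none else some { msgs := ζ.msgs.tail })
        queueReceive

end Specification

/-! ### Networks running AODV -/

/-- States `(ξ, p) ⟨⟨ (ζ, q)` of the process running on a node. -/
abbrev NodeState (IP : Type u) (D : Type v) : Type (max u v) :=
  (Val IP D × P IP D) × (QVal IP D × QP IP D)

/-- Network expressions; `N : Network IP D` stands for the encapsulated network `[N]`. -/
abbrev Network (IP : Type u) (D : Type v) : Type (max u v) := AWN.Net IP (NodeState IP D)

section Networks

variable {IP : Type u} {D : Type v}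

/-- The transitions of the process running on a node. -/
def NodeStep : NodeState IP D → AWN.Act IP D (Msg IP D) → NodeState IP D → Prop :=
  AWN.ParStep (AWN.SeqStep Γ) (AWN.SeqStep fun _ => bodyQMSG)

/-- The transitions of encapsulated networks. -/
def Step : Network IP D → AWN.ClosedAct IP D → Network IP D → Prop :=
  AWN.ClosedStep Msg.newpkt NodeStep

/-- The initial state of the process running on the node `ip`. -/
def initState (ip : IP) : NodeState IP D :=
  (({ ip := ip, sn := 1, rt := fun _ => none, rreqs := ∅, store := fun _ => none }, callAODV),
   ({ msgs := [] }, .call () fun ζ => some { msgs := ζ.msgs }))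

/-- Initial networks: the nodes have different addresses and are in their initial states, with
arbitrary transmission ranges. -/
def Initial (N : Network IP D) : Prop :=
  (N.nodes.map Prod.fst).Nodup ∧
    ∀ (a : IP) (s : NodeState IP D) (R : Set IP), (a, s, R) ∈ N.nodes → s = initState a

/-- Reachable network expressions. -/
def Reachable (N : Network IP D) : Prop :=
  ∃ N₀, Initial N₀ ∧ Relation.ReflTransGen (fun M M' => ∃ l, Step M l M') N₀ N

/-- The routing graph of `N` with respect to `dip`: there is an arc from a node `ip ≠ dip` to `ip'`
if the routing table of `ip` has a valid entry for `dip` with next hop `ip'`. -/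
def routingGraph (N : Network IP D) (dip : IP) : Digraph IP where
  Adj ip ip' := ip ≠ dip ∧
    ∃ ξ p Q R, (ip, ((ξ, p), Q), R) ∈ N.nodes ∧
      ∃ e, ξ.rt dip = some e ∧ e.flag = .val ∧ e.nhip = ip'

/-- A network is loop free if none of its routing graphs has a directed cycle.  The destination may
be any node identifier, whether or not it is the address of a node; only nodes of the network have
outgoing arcs, so that all vertices of a cycle are nodes of the network. -/
def LoopFree (N : Network IP D) : Prop :=
  ∀ dip ip : IP, ¬ Relation.TransGen (routingGraph N dip).Adj ip ip

end Networks

end AODV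

/-! ### Rely-guarantee contracts for sequential processes -/

namespace AWN

universe u v w x y z

/-! Order routes to a fixed destination lexicographically: a larger sequence number is better, and
among equal ones a smaller hop count. Along each arc of a routing graph into a node with an outgoing
arc, the route gets strictly better (`NetworkOK.route_lt`), so a cycle would make a route better
than itself.

The obstacle is that an entry was made from information its next hop had in the past. What makes old
information usable is monotonicity. `Covers` says that a node's table is at least as good as a given
route; an invalid entry counts only if its sequence number is strictly larger. Every change of a
table preserves coverage (`update_improves`, `addpreRT_improves`, `invalidate_improves`): error
handling is harmless because it strictly raises each known sequence number that it touches. Hence a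
coverage fact stays true forever once true.

The invariant has two halves. The next hop of a valid entry, unless it is the destination, covers a
route with the same sequence number and fewer hops (`TableOK`); and the sender of a request or reply
covers the route that the message advertises (`MsgOK`), including messages waiting in queues. The
two support each other: a received message justifies a new entry with one more hop, and the updated
table covers the route advertised on forwarding (`update_covers`), even if the old entry was kept.

Coverage facts about other nodes enter as a parameter, the `World`. Each process is verified once
against an arbitrary world by a weakest precondition (`wp_Γ`). In a network the world is read off
the actual tables; it grows with every transition, and all assertions are monotone in it
(`NetworkOK.step`). -/

/-- The message that is transmitted or sent by an action. -/
def Act.message {IP : Type u} {D : Type v} {M : Type w} : Act IP D M → Option M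
  | .broadcast m => some m
  | .groupcast _ m => some m
  | .unicast _ m => some m
  | .send m => some m
  | _ => none

/-- A rely-guarantee contract for sequential processes, relative to assertions `W` about the
environment. -/
structure Contract (M : Type w) (V : Type x) (X : Type y) (W : Type z) where
  /-- guaranteed for all changes of the valuation -/
  rel : W → V → V → Prop
  /-- preconditions of the named processes -/
  pre : W → X → V → Prop
  /-- guaranteed for messages that are sent -/
  snd : W → V → M → Prop
  /-- assumed for messages that are received -/
  rcv : W → M → Prop

section Contracts

variable {IP : Type u} {D : Type v} {M : Type w} {V : Type x} {X : Type y} {W : Type z}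
  [Preorder W]

/-- The weakest precondition under which a sequential process satisfies a contract. -/
def Contract.wp (C : Contract M V X W) : W → Proc IP D M V X → V → Prop
  | w, .call X f, ξ => ∀ ξ', f ξ = some ξ' →
      C.rel w ξ ξ' ∧ (∀ w', w ≤ w' → ∀ m, C.snd w' ξ' m → C.snd w' ξ m) ∧ C.pre w X ξ'
  | w, .choice p q, ξ => C.wp w p ξ ∧ C.wp w q ξ
  | w, .check φ p, ξ => ∀ ζ, φ ξ ζ → C.rel w ξ ζ ∧ C.wp w p ζ
  | w, .assign f p, ξ => ∀ ξ', f ξ = some ξ' → C.rel w ξ ξ' ∧ C.wp w p ξ'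
  | w, .broadcast ms p, ξ => (∀ m, ms ξ = some m → C.snd w ξ m) ∧ C.wp w p ξ
  | w, .groupcast _ ms p, ξ => (∀ m, ms ξ = some m → C.snd w ξ m) ∧ C.wp w p ξ
  | w, .unicast _ ms p q, ξ =>
      (∀ m, ms ξ = some m → C.snd w ξ m) ∧ C.wp w p ξ ∧ C.wp w q ξ
  | w, .send ms p, ξ => (∀ m, ms ξ = some m → C.snd w ξ m) ∧ C.wp w p ξ
  | w, .deliver _ p, ξ => C.wp w p ξ
  | w, .receive upd p, ξ => ∀ w', w ≤ w' → ∀ m, C.rcv w' m →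
      C.rel w' ξ (upd m ξ) ∧ C.wp w' p (upd m ξ)

/-- The guarantees of a contract persist when more is known about the environment. -/
structure Contract.Monotone (C : Contract M V X W) : Prop where
  rel_mono : ∀ {w w'}, w ≤ w' → ∀ {ξ ξ'}, C.rel w ξ ξ' → C.rel w' ξ ξ'
  pre_mono : ∀ {w w'}, w ≤ w' → ∀ {X ξ}, C.pre w X ξ → C.pre w' X ξ
  snd_mono : ∀ {w w'}, w ≤ w' → ∀ {ξ m}, C.snd w ξ m → C.snd w' ξ m
  rel_trans : ∀ {w ξ ξ' ξ''}, C.rel w ξ ξ' → C.rel w ξ' ξ'' → C.rel w ξ ξ''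
  rel_refl : ∀ {w ξ ξ'}, C.rel w ξ ξ' → C.rel w ξ' ξ'

/-- The clauses for `call` and `receive` quantify over all later worlds, so they restrict to larger
ones; the rest is monotonicity of the contract. -/
theorem Contract.Monotone.wp_mono {C : Contract M V X W} (hC : C.Monotone)
    {p : Proc IP D M V X} {w w' : W} (h : w ≤ w') {ξ : V} (hp : C.wp w p ξ) : C.wp w' p ξ := by
  induction p generalizing ξ with
  | call X f =>
    intro ξ' hξ'
    obtain ⟨h1, h2, h3⟩ := hp ξ' hξ'
    exact ⟨hC.rel_mono h h1, fun w'' hw => h2 w'' (h.trans hw), hC.pre_mono h h3⟩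
  | choice p q ihp ihq => exact ⟨ihp hp.1, ihq hp.2⟩
  | check φ p ih => exact fun ζ hζ => ⟨hC.rel_mono h (hp ζ hζ).1, ih (hp ζ hζ).2⟩
  | assign f p ih => exact fun ζ hζ => ⟨hC.rel_mono h (hp ζ hζ).1, ih (hp ζ hζ).2⟩
  | broadcast ms p ih => exact ⟨fun m hm => hC.snd_mono h (hp.1 m hm), ih hp.2⟩
  | groupcast ds ms p ih => exact ⟨fun m hm => hC.snd_mono h (hp.1 m hm), ih hp.2⟩
  | unicast d ms p q ihp ihq =>
    exact ⟨fun m hm => hC.snd_mono h (hp.1 m hm), ihp hp.2.1, ihq hp.2.2⟩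
  | send ms p ih => exact ⟨fun m hm => hC.snd_mono h (hp.1 m hm), ih hp.2⟩
  | deliver d p ih => exact ih hp
  | receive upd p ih => exact fun w'' hw => hp w'' (h.trans hw)

/-- Steps of a process preserve its weakest precondition and meet the guarantees. -/
theorem Contract.Monotone.seqStep {C : Contract M V X W} (hC : C.Monotone)
    {Γ : X → Proc IP D M V X} {w : W} (hΓ : ∀ X ξ, C.rel w ξ ξ → C.pre w X ξ → C.wp w (Γ X) ξ)
    {s s' : V × Proc IP D M V X} {a : Act IP D M} (hs : SeqStep Γ s a s')
    (hrel : C.rel w s.1 s.1) (hwp : C.wp w s.2 s.1) (hrcv : ∀ m, a = .receive m → C.rcv w m) :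
    C.rel w s.1 s'.1 ∧ C.wp w s'.2 s'.1 ∧ ∀ m, a.message = some m → C.snd w s.1 m := by
  induction hs with
  | call hf _ ih =>
    -- Unfolding a call is not a transition of its own: the change of valuation is composed with
    -- that of the following step, and `h2` carries message guarantees back to the caller's
    -- valuation. Recursion among process names is harmless because the induction is on the
    -- derivation of the step.
    obtain ⟨h1, h2, h3⟩ := hwp _ hf
    have hr := hC.rel_refl h1
    obtain ⟨i1, i2, i3⟩ := ih hr (hΓ _ _ hr h3) hrcv
    exact ⟨hC.rel_trans h1 i1, i2, fun m hm => h2 w le_rfl m (i3 m hm)⟩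
  | choiceLeft _ ih => exact ih hrel hwp.1 hrcv
  | choiceRight _ ih => exact ih hrel hwp.2 hrcv
  | check h => exact ⟨(hwp _ h).1, (hwp _ h).2, by simp [Act.message]⟩
  | assign h => exact ⟨(hwp _ h).1, (hwp _ h).2, by simp [Act.message]⟩
  | broadcast h =>
    exact ⟨hrel, hwp.2, by rintro m ⟨⟩; exact hwp.1 _ h⟩
  | groupcast _ h =>
    exact ⟨hrel, hwp.2, by rintro m ⟨⟩; exact hwp.1 _ h⟩
  | unicastSuccess _ h =>
    exact ⟨hrel, hwp.2.1, by rintro m ⟨⟩; exact hwp.1 _ h⟩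
  | unicastFailure _ h => exact ⟨hrel, hwp.2.2, by simp [Act.message]⟩
  | send h => exact ⟨hrel, hwp.2, by rintro m ⟨⟩; exact hwp.1 _ h⟩
  | deliver _ => exact ⟨hrel, hwp, by simp [Act.message]⟩
  | receive m =>
    obtain ⟨h1, h2⟩ := hwp w le_rfl m (hrcv m rfl)
    exact ⟨h1, h2, by simp [Act.message]⟩

end Contracts

/-! ### From network transitions to transitions of single nodes -/

section Networks

variable {IP : Type u} {D : Type v} {M : Type w} {S : Type x}

/-- The change of one node in a transition of a partial network, where `rcv` holds for the messages
that may arrive. -/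
def NodeChange (tr : S → Act IP D M → S → Prop) (rcv : M → Prop) (x y : IP × S × Set IP) : Prop :=
  x.1 = y.1 ∧ (x.2.1 = y.2.1 ∨
    ∃ a, tr x.2.1 a y.2.1 ∧ ∀ m, a = .receive m → rcv m)

/-- The messages that may arrive at nodes of a partial network in a transition. -/
def NetAct.arriving : NetAct IP D M → M → Prop
  | .cast _ m => fun m' => m' = m
  | .arrive _ _ m => fun m' => m' = m
  | _ => fun _ => False

/-- Transitions keep the shape of the parallel composition, so nodes correspond position by
position. Changes of range are ignored: topology plays no role in loop freedom. -/
theorem NetStep.forall₂ {tr : S → Act IP D M → S → Prop} {N N' : Net IP S} {l : NetAct IP D M}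
    (h : NetStep tr N l N') : List.Forall₂ (NodeChange tr l.arriving) N.nodes N'.nodes := by
  have idle (l : NetAct IP D M) (N : Net IP S) :
      List.Forall₂ (NodeChange tr l.arriving) N.nodes N.nodes :=
    List.forall₂_same.2 fun x _ => ⟨rfl, .inl rfl⟩
  induction h with
  | broadcast h | groupcast h | unicast h | notUnicast h | deliver h | tau h =>
    exact .cons ⟨rfl, .inr ⟨_, h, by simp⟩⟩ .nil
  | receive h => exact .cons ⟨rfl, .inr ⟨_, h, by simp [NetAct.arriving]⟩⟩ .nil
  | ignore | connectFrom | connectTo | connectOther | disconnectFrom | disconnectTo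
  | disconnectOther => exact .cons ⟨rfl, .inl rfl⟩ .nil
  | castLeft _ _ _ _ ih₁ ih₂ | castRight _ _ _ _ ih₁ ih₂ | arriveBoth _ _ ih₁ ih₂
  | connectBoth _ _ ih₁ ih₂ | disconnectBoth _ _ ih₁ ih₂ => exact List.rel_append ih₁ ih₂
  | deliverLeft _ ih | tauLeft _ ih => exact List.rel_append ih (idle _ _)
  | deliverRight _ ih | tauRight _ ih => exact List.rel_append (idle _ _) ih

/-- In a parallel composition the `cast` label comes from exactly one component; following it down
ends at the transmitting node. -/
theorem NetStep.exists_sender {tr : S → Act IP D M → S → Prop} {N N' : Net IP S} {R : Set IP}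
    {m : M} (h : NetStep tr N (.cast R m) N') :
    ∃ x ∈ N.nodes, ∃ a s, tr x.2.1 a s ∧ a.message = some m ∧ ∀ m', a ≠ .receive m' := by
  generalize hl : NetAct.cast R m = l at h
  induction h with
  | broadcast h | groupcast h | unicast h =>
    cases hl
    exact ⟨_, List.mem_singleton_self _, _, _, h, rfl, by simp⟩
  | castLeft _ _ _ _ ih _ =>
    cases hl
    obtain ⟨x, hx, h⟩ := ih rfl
    exact ⟨x, List.mem_append_left _ hx, h⟩
  | castRight _ _ _ _ _ ih =>
    cases hl
    obtain ⟨x, hx, h⟩ := ih rfl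
    exact ⟨x, List.mem_append_right _ hx, h⟩
  | _ => cases hl

/-- In a transition of an encapsulated network, a message can only arrive at a node if it is a
new packet or transmitted by a node. -/
theorem ClosedStep.forall₂ {newpkt : D → IP → M} {tr : S → Act IP D M → S → Prop}
    {N N' : Net IP S} {l : ClosedAct IP D} (h : ClosedStep newpkt tr N l N') :
    List.Forall₂ (NodeChange tr fun m => (∃ d dip, m = newpkt d dip) ∨
      ∃ x ∈ N.nodes, ∃ a s, tr x.2.1 a s ∧ a.message = some m ∧ ∀ m', a ≠ .receive m')
      N.nodes N'.nodes := by
  have weaken {P Q : M → Prop} (hPQ : ∀ m, P m → Q m)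
      (h : List.Forall₂ (NodeChange tr P) N.nodes N'.nodes) :
      List.Forall₂ (NodeChange tr Q) N.nodes N'.nodes :=
    h.imp fun x y hxy => ⟨hxy.1, hxy.2.imp_right fun ⟨a, ha, hm⟩ =>
      ⟨a, ha, fun m e => hPQ m (hm m e)⟩⟩
  cases h with
  | cast h => exact weaken (by rintro _ rfl; exact .inr h.exists_sender) h.forall₂
  | newpkt h => exact weaken (by rintro _ rfl; exact .inl ⟨_, _, rfl⟩) h.forall₂
  | deliver h | connect h | disconnect h | tau h => exact weaken (by rintro _ ⟨⟩) h.forall₂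

end Networks

end AWN

namespace AODV

universe u v

/-! ### Coverage of routes and the operations on routing tables -/

section RouteQuality

variable {IP : Type u}

/-- The routing table has an entry for `dip` that is at least as good as a valid route with known
sequence number `n` and hop count `h`, or an invalid entry that is more recent than such a route. -/
def Covers (rt : RT IP) (dip : IP) (n h : ℕ) : Prop :=
  1 ≤ n ∧ ∃ e, rt dip = some e ∧ (n < e.dsn ∨ n = e.dsn ∧ e.hops ≤ h ∧ e.flag = .val)

/-- All routes that are covered by `rt` are covered by `rt'`. -/
def Improves (rt rt' : RT IP) : Prop := ∀ dip n h, Covers rt dip n h → Covers rt' dip n h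

theorem Improves.refl (rt : RT IP) : Improves rt rt := fun _ _ _ h => h

theorem Improves.trans {rt rt' rt'' : RT IP} (h : Improves rt rt') (h' : Improves rt' rt'') :
    Improves rt rt'' := fun _ _ _ hc => h' _ _ _ (h _ _ _ hc)

/-- Assertions about the routing tables of the other nodes: `w x dip n h` says that the node `x`
covers a route to `dip` with sequence number `n` and hop count `h`. -/
abbrev World (IP : Type u) : Type u := IP → IP → ℕ → ℕ → Prop

/-- The next hop of a valid entry, unless it is the destination, has a strictly better route. -/
def EntryOK (w : World IP) (dip : IP) (e : Entry IP) : Prop :=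
  1 ≤ e.hops ∧ (e.dsk = .kno → 1 ≤ e.dsn) ∧
    (e.flag = .val → e.nhip ≠ dip → ∃ h < e.hops, w e.nhip dip e.dsn h)

def TableOK (w : World IP) (rt : RT IP) : Prop := ∀ dip e, rt dip = some e → EntryOK w dip e

theorem EntryOK.mono {w w' : World IP} (hw : w ≤ w') {dip : IP} {e : Entry IP}
    (h : EntryOK w dip e) : EntryOK w' dip e :=
  ⟨h.1, h.2.1, fun hv hn => (h.2.2 hv hn).imp fun _ hh => ⟨hh.1, hw _ _ _ _ hh.2⟩⟩

theorem TableOK.mono {w w' : World IP} (hw : w ≤ w') {rt : RT IP} (h : TableOK w rt) :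
    TableOK w' rt := fun dip e he => (h dip e he).mono hw

/-- A table is improved if its entries are replaced by entries that are at least as good. -/
theorem Improves.of_entries {rt rt' : RT IP}
    (h : ∀ dip e, rt dip = some e → ∃ e', rt' dip = some e' ∧ (1 ≤ e.dsn → e.dsn < e'.dsn ∨
      e.dsn = e'.dsn ∧ (e.flag = .val → e'.hops ≤ e.hops ∧ e'.flag = .val))) :
    Improves rt rt' := by
  rintro dip n k ⟨hn, e, he, hc⟩
  obtain ⟨e', he', h'⟩ := h dip e he
  refine ⟨hn, e', he', ?_⟩
  -- In both cases `1 ≤ n` yields `1 ≤ e.dsn`, so entries with unknown sequence number need no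
  -- comparison.
  rcases hc with hc | ⟨h1, h2, h3⟩
  · rcases h' (by lia) with h' | h' <;> left <;> lia
  · rcases h' (by lia) with h' | ⟨h4, h5⟩
    · left; lia
    · right; exact ⟨h1.trans h4, (h5 h3).1.trans h2, (h5 h3).2⟩

theorem addpreRT_eq {rt rt' : RT IP} {d : IP} {X : Set IP} (h : addpreRT rt d X = some rt')
    (dip : IP) : ∃ Y : Entry IP → Set IP, rt' dip = (rt dip).map fun e => { e with pre := Y e } := by
  classical
  simp only [addpreRT, Option.map_eq_some_iff] at h
  obtain ⟨e, he, rfl⟩ := h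
  by_cases hd : dip = d
  · subst hd
    exact ⟨fun e => e.pre ∪ X, by simp [he, addpre]⟩
  · exact ⟨fun e => e.pre, by simp [Function.update_of_ne hd]⟩

theorem addpreRT_improves {rt rt' : RT IP} {d : IP} {X : Set IP} (h : addpreRT rt d X = some rt') :
    Improves rt rt' := .of_entries fun dip e he => by
  obtain ⟨Y, hY⟩ := addpreRT_eq h dip
  exact ⟨{ e with pre := Y e }, by rw [hY, he]; rfl, fun _ => .inr ⟨rfl, fun hv => ⟨le_rfl, hv⟩⟩⟩

theorem addpreRT_tableOK {w : World IP} {rt rt' : RT IP} {d : IP} {X : Set IP}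
    (h : addpreRT rt d X = some rt') (hrt : TableOK w rt) : TableOK w rt' := by
  intro dip e he
  obtain ⟨Y, hY⟩ := addpreRT_eq h dip
  rw [hY, Option.map_eq_some_iff] at he
  obtain ⟨e', he', rfl⟩ := he
  exact hrt dip e' he'

theorem addpreRT_entry {rt rt' : RT IP} {d : IP} {X : Set IP} (h : addpreRT rt d X = some rt')
    {dip : IP} (hv : ∃ e, rt dip = some e ∧ e.flag = .val ∧ e.dsk = .kno) :
    ∃ e, rt' dip = some e ∧ e.flag = .val ∧ e.dsk = .kno := by
  obtain ⟨e, he, h1, h2⟩ := hv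
  obtain ⟨Y, hY⟩ := addpreRT_eq h dip
  exact ⟨{ e with pre := Y e }, by rw [hY, he]; rfl, h1, h2⟩

/-- A strictly larger sequence number outweighs the loss of validity. The hypothesis exempts the
number `0`, which `inc` leaves fixed and which covers nothing. -/
theorem invalidate_improves {rt : RT IP} {dests : IP → Option SQN}
    (h : ∀ dip n e, dests dip = some n → rt dip = some e → e.dsn ≤ n ∧ (1 ≤ e.dsn → e.dsn < n)) :
    Improves rt (invalidate rt dests) := .of_entries fun dip e he => by
  cases hd : dests dip with
  | none => exact ⟨e, by simp [invalidate, he, hd], fun _ => .inr ⟨rfl, fun hv => ⟨le_rfl, hv⟩⟩⟩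
  | some n =>
    exact ⟨{ e with dsn := n, flag := .inval }, by simp only [invalidate, he, hd], fun h1 => .inl ((h _ _ _ hd he).2 h1)⟩

/-- The next-hop condition is void for invalid entries; only positivity of known sequence numbers
has to survive, for which `e.dsn ≤ n` suffices. -/
theorem invalidate_tableOK {w : World IP} {rt : RT IP} {dests : IP → Option SQN}
    (h : ∀ dip n e, dests dip = some n → rt dip = some e → e.dsn ≤ n ∧ (1 ≤ e.dsn → e.dsn < n))
    (hrt : TableOK w rt) : TableOK w (invalidate rt dests) := by
  intro dip e he
  cases hr : rt dip with
  | none => simp [invalidate, hr] at he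
  | some s =>
    have hs := hrt dip s hr
    cases hd : dests dip with
    | none =>
      simp only [invalidate, hr, hd, Option.some.injEq] at he
      exact he ▸ hs
    | some n =>
      simp only [invalidate, hr, hd, Option.some.injEq] at he
      subst he
      exact ⟨hs.1, fun hk => (hs.2.1 hk).trans (h _ _ _ hd hr).1, fun hf => nomatch hf⟩

/-- What `update` does with a new entry `r` and the old entry `s`. -/
theorem update_spec {rt rt' : RT IP} {dip : IP} {r : Entry IP} (h : update rt dip r = some rt') :
    r.flag = .val ∧ (r.dsk = .kno → 1 ≤ r.dsn) ∧ (∀ d ≠ dip, rt' d = rt d) ∧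
      ∃ e, rt' dip = some e ∧
        ((e.dsn = r.dsn ∧ e.hops = r.hops ∧ e.dsk = r.dsk ∧ e.flag = r.flag ∧ e.nhip = r.nhip ∧
            ∀ s, rt dip = some s → s.dsn < r.dsn ∨ s.dsn = r.dsn ∧
              (s.flag = .val → r.hops < s.hops)) ∨
          ∃ s, rt dip = some s ∧ e.dsn = s.dsn ∧
            ((e.hops = r.hops ∧ e.dsk = r.dsk ∧ e.flag = r.flag ∧ e.nhip = r.nhip ∧
                r.dsk = .unk ∧ r.hops = 1) ∨
              (e.hops = s.hops ∧ e.dsk = s.dsk ∧ e.flag = s.flag ∧ e.nhip = s.nhip ∧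
                (r.dsn < s.dsn ∨ r.dsn = s.dsn ∧ s.hops ≤ r.hops ∧ s.flag = .val)))) := by
  classical
  by_cases hr : r.flag = .val ∧ (r.dsn = 0 ↔ r.dsk = .unk) ∧ (r.dsk = .unk → r.hops = 1)
  swap
  · simp [update, hr] at h
  rw [update, if_pos hr] at h
  obtain ⟨h1, h2, h3⟩ := hr
  refine ⟨h1, fun hk => ?_, ?_⟩
  · by_contra h0
    have := h2.1 (by lia)
    simp [hk] at this
  cases hs : rt dip with
  | none =>
    simp only [hs, Option.some.injEq] at h
    subst h
    exact ⟨fun d hd => Function.update_of_ne hd _ _, r, Function.update_self _ _ _,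
      .inl ⟨rfl, rfl, rfl, rfl, rfl, by simp⟩⟩
  | some s =>
    simp only [hs, Option.some.injEq] at h
    subst h
    refine ⟨fun d hd => Function.update_of_ne hd _ _, _, Function.update_self _ _ _, ?_⟩
    split_ifs with c1 c2 c3 c4
    · exact .inl ⟨rfl, rfl, rfl, rfl, rfl, by rintro _ ⟨⟩; exact .inl c1⟩
    · exact .inl ⟨rfl, rfl, rfl, rfl, rfl, by rintro _ ⟨⟩; exact .inr ⟨c2.1, fun _ => c2.2⟩⟩
    · exact .inl ⟨rfl, rfl, rfl, rfl, rfl, by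
        rintro _ ⟨⟩; exact .inr ⟨c3.1, fun hv => by simp [hv] at c3⟩⟩
    · exact .inr ⟨s, rfl, rfl, .inl ⟨rfl, rfl, rfl, rfl, c4, h3 c4⟩⟩
    -- The old entry is kept only if it is at least as good as `r`: more recent, or equally recent,
    -- valid and not longer.
    · refine .inr ⟨s, rfl, rfl, .inr ⟨rfl, rfl, rfl, rfl, ?_⟩⟩
      rcases Nat.lt_or_ge r.dsn s.dsn with c | c
      · exact .inl c
      · have c : r.dsn = s.dsn := by lia
        refine .inr ⟨c, by by_contra; exact c2 ⟨c.symm, by lia⟩, ?_⟩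
        cases hf : s.flag with
        | val => rfl
        | inval => exact absurd ⟨c.symm, hf⟩ c3

theorem update_improves {w : World IP} {rt rt' : RT IP} {dip : IP} {r : Entry IP}
    (h : update rt dip r = some rt') (hrt : TableOK w rt) : Improves rt rt' := by
  obtain ⟨h1, -, h3, e, he, h4⟩ := update_spec h
  refine .of_entries fun d s hs => ?_
  by_cases hd : d = dip
  · subst hd
    refine ⟨e, he, fun _ => ?_⟩
    rcases h4 with ⟨c1, c2, c3, c4, c5, c6⟩ | ⟨s', hs', c1, ⟨c2, c3, c4, c5, c6, c7⟩ | c2⟩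
    · rcases c6 s hs with c6 | ⟨c6, c7⟩
      · left; lia
      · exact .inr ⟨by lia, fun hv => ⟨by have := c7 hv; lia, c4.trans h1⟩⟩
    · obtain rfl : s = s' := by simpa [hs] using hs'
      -- An update with unknown sequence number keeps the old number and sets the hop count to 1,
      -- which cannot exceed the old one. This is why `EntryOK` demands `1 ≤ e.hops`.
      have := (hrt _ _ hs).1
      exact .inr ⟨c1.symm, fun hv => ⟨by lia, c4.trans h1⟩⟩
    · obtain rfl : s = s' := by simpa [hs] using hs'
      exact .inr ⟨c1.symm, fun hv => ⟨c2.1.le, c2.2.2.1.trans hv⟩⟩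
  · exact ⟨s, by rw [h3 d hd, hs], fun _ => .inr ⟨rfl, fun hv => ⟨le_rfl, hv⟩⟩⟩

/-- The delicate case is a new entry that inherits the old sequence number, about which its next hop
may know nothing. It arises only for status `unk`, and `hn` then forces the next hop to be the
destination itself. -/
theorem update_tableOK {w : World IP} {rt rt' : RT IP} {dip : IP} {r : Entry IP}
    (h : update rt dip r = some rt') (hrt : TableOK w rt) (hr : 1 ≤ r.hops)
    (hn : r.nhip ≠ dip → r.dsk = .kno ∧ ∃ h < r.hops, w r.nhip dip r.dsn h) : TableOK w rt' := by
  obtain ⟨h1, h2, h3, e, he, h4⟩ := update_spec h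
  intro d s hs
  by_cases hd : d = dip
  · subst hd
    obtain rfl : e = s := by simpa [he] using hs
    rcases h4 with ⟨c1, c2, c3, c4, c5, c6⟩ | ⟨s', hs', c1, ⟨c2, c3, c4, c5, c6, c7⟩ | c2⟩
    · exact ⟨by lia, fun hk => by rw [c1]; exact h2 (c3 ▸ hk), fun _ => by
        rw [c5, c1, c2]; exact fun hne => (hn hne).2⟩
    · refine ⟨by lia, fun hk => ?_, fun _ hne => ?_⟩
      · rw [c3, c6] at hk; cases hk
      · have := (hn (c5 ▸ hne)).1
        rw [c6] at this; cases this
    · have := hrt _ _ hs'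
      rwa [EntryOK, ← c2.1, ← c1, ← c2.2.1, ← c2.2.2.1, ← c2.2.2.2.1] at this
  · exact hrt d s (by rw [← h3 d hd, hs])

/-- Either `r` was installed or the old entry was at least as good. Hence a node may forward the
values of the received message rather than those in its table. -/
theorem update_covers {rt rt' : RT IP} {dip : IP} {r : Entry IP}
    (h : update rt dip r = some rt') (hk : r.dsk = .kno) : Covers rt' dip r.dsn r.hops := by
  obtain ⟨h1, h2, -, e, he, h4⟩ := update_spec h
  refine ⟨h2 hk, e, he, ?_⟩
  rcases h4 with ⟨c1, c2, c3, c4, c5, c6⟩ | ⟨s', hs', c1, ⟨c2, c3, c4, c5, c6, c7⟩ | c2⟩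
  · exact .inr ⟨c1.symm, c2.le, c4.trans h1⟩
  · rw [hk] at c6; cases c6
  · rw [c1, c2.1, c2.2.2.1]
    exact c2.2.2.2.2

end RouteQuality

/-! ### The contract of AODV -/

section Processes

variable {IP : Type u} {D : Type v}

/-- The sender of a route request or reply covers the route back to its origin. -/
def MsgOK (w : World IP) : Msg IP D → Prop
  | .rreq hops _ _ _ _ oip osn sip => oip ≠ sip → w sip oip osn hops
  | .rrep hops dip dsn _ sip => dip ≠ sip → w sip dip dsn hops
  | _ => True

theorem MsgOK.mono {w w' : World IP} (hw : w ≤ w') {m : Msg IP D} (h : MsgOK w m) :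
    MsgOK w' m := by
  cases m with
  | rreq | rrep => exact fun hne => hw _ _ _ _ (h hne)
  | _ => trivial

/-- The assertions that hold by the routing table of a single node. -/
def Val.world (ξ : Val IP D) : World IP := fun x dip n h => x = ξ.ip ∧ Covers ξ.rt dip n h

/-- The contract between a node running AODV and its environment. -/
def contract (IP : Type u) (D : Type v) :
    AWN.Contract (Msg IP D) (Val IP D) Name (World IP) where
  rel w ξ ξ' := ξ'.ip = ξ.ip ∧ Improves ξ.rt ξ'.rt ∧ TableOK w ξ'.rt
  pre w
    | .rreq, ξ => ∀ oip sip osn hops, ξ.oip = some oip → ξ.sip = some sip → ξ.osn = some osn →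
        ξ.hops = some hops → oip ≠ sip → w sip oip osn hops
    | .rrep, ξ => ∀ dip sip dsn hops, ξ.dip = some dip → ξ.sip = some sip → ξ.dsn = some dsn →
        ξ.hops = some hops → dip ≠ sip → w sip dip dsn hops
    | _, _ => True
  snd _ ξ m := MsgOK ξ.world m
  rcv w m := MsgOK w m

theorem contract_monotone : (contract IP D).Monotone where
  rel_mono hw _ _ h := ⟨h.1, h.2.1, h.2.2.mono hw⟩
  pre_mono := by
    intro w w' hw X ξ h
    cases X with
    | rreq | rrep => exact fun a b c d h1 h2 h3 h4 h5 => hw _ _ _ _ (h a b c d h1 h2 h3 h4 h5)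
    | _ => trivial
  snd_mono _ _ _ h := h
  rel_trans h h' := ⟨h'.1.trans h.1, h.2.1.trans h'.2.1, h'.2.2⟩
  rel_refl h := ⟨rfl, .refl _, h.2.2⟩

theorem contract_rel_self {w : World IP} {ξ ξ' : Val IP D} (h : TableOK w ξ.rt)
    (hip : ξ'.ip = ξ.ip) (hrt : ξ'.rt = ξ.rt) : (contract IP D).rel w ξ ξ' :=
  ⟨hip, hrt ▸ .refl _, hrt ▸ h⟩

/-- Passing arguments alters neither the address nor the table, so the world of the node, by which
its messages are judged, stays the same. -/
theorem contract_call {w : World IP} {ξ ξ' : Val IP D} {X : Name} (h : TableOK w ξ.rt)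
    (hip : ξ'.ip = ξ.ip) (hrt : ξ'.rt = ξ.rt) (hX : (contract IP D).pre w X ξ') :
    (contract IP D).rel w ξ ξ' ∧ (∀ w', w ≤ w' → ∀ m, (contract IP D).snd w' ξ' m →
      (contract IP D).snd w' ξ m) ∧ (contract IP D).pre w X ξ' :=
  ⟨contract_rel_self h hip hrt, fun _ _ m hm => by
    have : ξ'.world = ξ.world := by unfold Val.world; rw [hip, hrt]
    change MsgOK ξ.world m
    rw [← this]
    exact hm, hX⟩

/-! ### Verification of the processes -/

theorem wp_callAODV {w : World IP} {ξ : Val IP D} (h : TableOK w ξ.rt) :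
    (contract IP D).wp w callAODV ξ := by
  rintro _ ⟨⟩
  exact contract_call h rfl rfl trivial

theorem wp_invalidateAndInform {w : World IP} {ξ : Val IP D} (h : TableOK w ξ.rt)
    (hd : ∀ dests, ξ.dests = some dests → ∀ dip n e, dests dip = some n → ξ.rt dip = some e →
      e.dsn ≤ n ∧ (1 ≤ e.dsn → e.dsn < n)) :
    (contract IP D).wp w invalidateAndInform ξ := by
  simp only [invalidateAndInform, AWN.Contract.wp, Option.bind_eq_some_iff, Option.some.injEq]
  rintro _ ⟨dests, hdests, rfl⟩
  have h' := invalidate_tableOK (hd _ hdests) h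
  refine ⟨⟨rfl, invalidate_improves (hd _ hdests), h'⟩, ?_⟩
  rintro _ ⟨dests, -, rfl⟩
  refine ⟨contract_rel_self h' rfl rfl, ?_⟩
  rintro _ ⟨dests, -, rfl⟩
  refine ⟨contract_rel_self h' rfl rfl, ?_⟩
  rintro _ ⟨dests, -, rfl⟩
  refine ⟨contract_rel_self h' rfl rfl, ?_, wp_callAODV h'⟩
  rintro _ ⟨dests, -, rfl⟩
  trivial

/-- `inc` strictly raises known sequence numbers and fixes `0`, exactly as invalidation requires. -/
theorem wp_linkBreak {w : World IP} {ξ : Val IP D} {dst : Val IP D → Option IP}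
    (h : TableOK w ξ.rt) : (contract IP D).wp w (linkBreak dst) ξ := by
  simp only [linkBreak, AWN.Contract.wp, Option.bind_eq_some_iff, Option.some.injEq]
  rintro _ ⟨d, -, rfl⟩
  refine ⟨contract_rel_self h rfl rfl, wp_invalidateAndInform h ?_⟩
  rintro _ ⟨⟩ dip n e hn he
  dsimp only at hn he
  split_ifs at hn
  cases hn
  simp only [sqn, he, Option.elim_some, inc]
  split_ifs <;> lia

/-- The next hop of the new route is its destination, so nothing needs to be known about the
sender's table. -/
theorem wp_updateSender {w : World IP} {ξ : Val IP D} {p : P IP D} (h : TableOK w ξ.rt)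
    (hp : ∀ rt, TableOK w rt → (contract IP D).wp w p { ξ with rt := rt }) :
    (contract IP D).wp w (updateSender p) ξ := by
  simp only [updateSender, AWN.Contract.wp, Option.bind_eq_some_iff, Option.some.injEq]
  rintro _ ⟨sip, -, rt', hrt', rfl⟩
  have h' := update_tableOK hrt' h le_rfl fun hne => absurd rfl hne
  exact ⟨⟨rfl, update_improves hrt' h, h'⟩, hp _ h'⟩

theorem wp_bodyAODVReceive {w : World IP} {ξ : Val IP D} (h : TableOK w ξ.rt) :
    (contract IP D).wp w bodyAODVReceive ξ := by
  rintro w' hw m hm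
  -- The message may arrive much later, in a larger world.
  replace h := h.mono hw
  refine ⟨contract_rel_self h rfl rfl, ?_, ?_, ?_, ?_, ?_⟩
  · rintro _ ⟨data, dip, -, rfl⟩
    exact ⟨contract_rel_self h rfl rfl, by rintro _ ⟨⟩; exact contract_call h rfl rfl trivial⟩
  · rintro _ ⟨data, dip, oip, -, rfl⟩
    exact ⟨contract_rel_self h rfl rfl, by rintro _ ⟨⟩; exact contract_call h rfl rfl trivial⟩
  · rintro _ ⟨hops, rreqid, dip, dsn, dsk, oip, osn, sip, ⟨⟩, rfl⟩
    refine ⟨contract_rel_self h rfl rfl, wp_updateSender h fun rt hrt => ?_⟩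
    rintro _ ⟨⟩
    refine contract_call hrt rfl rfl ?_
    rintro _ _ _ _ ⟨⟩ ⟨⟩ ⟨⟩ ⟨⟩
    exact hm
  · rintro _ ⟨hops, dip, dsn, oip, sip, ⟨⟩, rfl⟩
    refine ⟨contract_rel_self h rfl rfl, wp_updateSender h fun rt hrt => ?_⟩
    rintro _ ⟨⟩
    refine contract_call hrt rfl rfl ?_
    rintro _ _ _ _ ⟨⟩ ⟨⟩ ⟨⟩ ⟨⟩
    exact hm
  · rintro _ ⟨dests, sip, -, rfl⟩
    refine ⟨contract_rel_self h rfl rfl, wp_updateSender h fun rt hrt => ?_⟩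
    rintro _ ⟨⟩
    exact contract_call hrt rfl rfl trivial

theorem wp_bodyAODVSend {w : World IP} {ξ : Val IP D} (h : TableOK w ξ.rt) :
    (contract IP D).wp w bodyAODVSend ξ := by
  simp only [bodyAODVSend, AWN.Contract.wp, Option.bind_eq_some_iff, Option.some.injEq]
  rintro _ ⟨dip, -, rfl⟩
  refine ⟨contract_rel_self h rfl rfl, ?_⟩
  rintro _ ⟨_, -, d, -, rfl⟩
  refine ⟨contract_rel_self h rfl rfl, ?_, ?_, wp_linkBreak h⟩
  · rintro _ ⟨_, -, _, -, rfl⟩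
    trivial
  · rintro _ ⟨_, -, store, -, rfl⟩
    exact ⟨contract_rel_self h rfl rfl, wp_callAODV h⟩

theorem wp_bodyAODVRequest {w : World IP} {ξ : Val IP D} (h : TableOK w ξ.rt) :
    (contract IP D).wp w bodyAODVRequest ξ := by
  simp only [bodyAODVRequest, AWN.Contract.wp, Option.bind_eq_some_iff, Option.some.injEq]
  rintro _ ⟨dip, -, -, rfl⟩
  refine ⟨contract_rel_self h rfl rfl, ?_⟩
  rintro _ ⟨_, -, rfl⟩
  refine ⟨contract_rel_self h rfl rfl, ?_⟩
  rintro _ rfl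
  refine ⟨contract_rel_self h rfl rfl, ?_⟩
  rintro _ rfl
  refine ⟨contract_rel_self h rfl rfl, ?_⟩
  rintro _ ⟨_, -, rfl⟩
  refine ⟨contract_rel_self h rfl rfl, ?_, wp_callAODV h⟩
  -- Originator and sender coincide, so `MsgOK` is vacuous.
  rintro _ ⟨_, -, _, -, rfl⟩ hne
  exact absurd rfl hne

theorem wp_bodyNEWPKT {w : World IP} {ξ : Val IP D} (h : TableOK w ξ.rt) :
    (contract IP D).wp w bodyNEWPKT ξ := by
  simp only [bodyNEWPKT, AWN.Contract.wp, Option.bind_eq_some_iff, Option.some.injEq]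
  constructor
  · rintro _ ⟨-, rfl⟩
    exact ⟨contract_rel_self h rfl rfl, wp_callAODV h⟩
  · rintro _ ⟨-, rfl⟩
    refine ⟨contract_rel_self h rfl rfl, ?_⟩
    rintro _ ⟨_, -, _, -, rfl⟩
    exact ⟨contract_rel_self h rfl rfl, wp_callAODV h⟩

theorem wp_bodyPKT {w : World IP} {ξ : Val IP D} (h : TableOK w ξ.rt) :
    (contract IP D).wp w bodyPKT ξ := by
  simp only [bodyPKT, AWN.Contract.wp, Option.bind_eq_some_iff, Option.some.injEq]
  have hself := contract_rel_self h rfl rfl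
  constructor
  · rintro _ ⟨-, rfl⟩
    exact ⟨hself, wp_callAODV h⟩
  rintro _ ⟨-, rfl⟩
  refine ⟨hself, ?_, ?_⟩
  · rintro _ ⟨-, rfl⟩
    refine ⟨hself, ?_, wp_callAODV h, wp_linkBreak h⟩
    rintro _ ⟨_, -, _, -, _, -, rfl⟩
    trivial
  rintro _ ⟨-, rfl⟩
  refine ⟨hself, ?_, ?_⟩
  · rintro _ ⟨-, rfl⟩
    refine ⟨hself, ?_, wp_callAODV h⟩
    rintro _ ⟨_, -, rfl⟩
    trivial
  · rintro _ ⟨-, rfl⟩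
    exact ⟨hself, wp_callAODV h⟩

/-- The test `sqn(rt, rip) < rsn` alone makes invalidation an improvement. Error messages therefore
need no correctness condition in `MsgOK`. -/
theorem wp_bodyRERR {w : World IP} {ξ : Val IP D} (h : TableOK w ξ.rt) :
    (contract IP D).wp w bodyRERR ξ := by
  simp only [bodyRERR, AWN.Contract.wp, Option.bind_eq_some_iff, Option.some.injEq]
  rintro _ ⟨dests, -, sip, -, rfl⟩
  refine ⟨contract_rel_self h rfl rfl, wp_invalidateAndInform h ?_⟩
  rintro _ ⟨⟩ dip n e hn he
  dsimp only at hn he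
  split_ifs at hn with hc
  obtain ⟨rsn, h1, -, -, h2⟩ := hc
  simp only [hn, Option.some.injEq] at h1
  simp only [sqn, he, Option.elim_some] at h2
  lia

theorem wp_bodyRREQ {w : World IP} {ξ : Val IP D} (h : TableOK w ξ.rt)
    (hpre : (contract IP D).pre w .rreq ξ) : (contract IP D).wp w bodyRREQ ξ := by
  simp only [bodyRREQ, AWN.Contract.wp, Option.bind_eq_some_iff, Option.some.injEq]
  constructor
  · rintro _ ⟨-, rfl⟩
    exact ⟨contract_rel_self h rfl rfl, wp_callAODV h⟩
  rintro _ ⟨-, rfl⟩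
  refine ⟨contract_rel_self h rfl rfl, ?_⟩
  rintro _ ⟨oip, hoip, osn, hosn, hops, hhops, sip, hsip, rt, hrt, rfl⟩
  -- The sender covers the route with `hops` hops, and the new entry has `hops + 1`: this is the
  -- strict decrease.
  have h' : TableOK w rt := update_tableOK hrt h (by simp) fun hne =>
    ⟨rfl, hops, by simp, hpre _ _ _ _ hoip hsip hosn hhops hne.symm⟩
  have hcov : Covers rt oip osn (hops + 1) := update_covers hrt rfl
  refine ⟨⟨rfl, update_improves hrt h, h'⟩, ?_⟩
  rintro _ ⟨_, -, rreqid, -, rfl⟩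
  refine ⟨contract_rel_self h' rfl rfl, ?_, ?_⟩
  · rintro _ ⟨hip, rfl⟩
    refine ⟨contract_rel_self h' rfl rfl, ?_⟩
    rintro _ ⟨dsn, -, rfl⟩
    refine ⟨contract_rel_self h' rfl rfl, ?_, wp_callAODV h', wp_linkBreak h'⟩
    rintro _ ⟨dip, hdip, _, -, rfl⟩ hne
    exact absurd (Option.some.inj (hdip.symm.trans hip)) hne
  rintro _ ⟨-, rfl⟩
  refine ⟨contract_rel_self h' rfl rfl, ?_, ?_⟩
  · rintro _ ⟨⟨dip, dsn, hdip, hdsn, ⟨e, he, hval⟩, -, hkno⟩, rfl⟩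
    refine ⟨contract_rel_self h' rfl rfl, ?_⟩
    -- Known status yields a positive sequence number, without which the advertised route would not
    -- count as covered; adding precursors preserves it.
    have hentry : ∃ e, rt dip = some e ∧ e.flag = .val ∧ e.dsk = .kno :=
      ⟨e, he, hval, by simpa [sqnf, show rt dip = some e from he] using hkno⟩
    rintro _ ⟨_, -, _, -, rt₁, hrt₁, rfl⟩
    have h₁ := addpreRT_tableOK hrt₁ h'
    refine ⟨⟨rfl, addpreRT_improves hrt₁, h₁⟩, ?_⟩
    rintro _ ⟨_, -, _, -, _, -, rt₂, hrt₂, rfl⟩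
    have h₂ := addpreRT_tableOK hrt₂ h₁
    refine ⟨⟨rfl, addpreRT_improves hrt₂, h₂⟩, ?_, wp_callAODV h₂, wp_linkBreak h₂⟩
    rintro _ ⟨_, hdip', _, -, k, hk, rfl⟩ -
    obtain rfl := Option.some.inj (hdip.symm.trans hdip')
    obtain ⟨e, he, hval, hkno⟩ := addpreRT_entry hrt₂ (addpreRT_entry hrt₁ hentry)
    simp only [dhops, he, Option.map_some, Option.some.injEq] at hk
    have hn : sqn rt₂ dip = e.dsn := by simp [sqn, he]
    exact ⟨rfl, hn ▸ (h₂ _ _ he).2.1 hkno, e, he, .inr ⟨hn, hk.le, hval⟩⟩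
  · rintro _ ⟨-, rfl⟩
    refine ⟨contract_rel_self h' rfl rfl, ?_, wp_callAODV h'⟩
    rintro _ ⟨_, hhops', _, -, _, -, _, -, _, -, _, hoip', _, hosn', rfl⟩ -
    obtain rfl := Option.some.inj (hhops.symm.trans hhops')
    obtain rfl := Option.some.inj (hoip.symm.trans hoip')
    obtain rfl := Option.some.inj (hosn.symm.trans hosn')
    exact ⟨rfl, hcov⟩

theorem wp_bodyRREP {w : World IP} {ξ : Val IP D} (h : TableOK w ξ.rt)
    (hpre : (contract IP D).pre w .rrep ξ) : (contract IP D).wp w bodyRREP ξ := by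
  simp only [bodyRREP, forwardUpdate, AWN.Contract.wp, Option.bind_eq_some_iff, Option.some.injEq]
  constructor
  swap
  · rintro _ ⟨-, rfl⟩
    exact ⟨contract_rel_self h rfl rfl, wp_callAODV h⟩
  rintro _ ⟨-, rfl⟩
  refine ⟨contract_rel_self h rfl rfl, ?_⟩
  rintro _ ⟨rt, ⟨dip, hdip, dsn, hdsn, hops, hhops, sip, hsip, hrt⟩, rfl⟩
  have h' : TableOK w rt := update_tableOK hrt h (by simp) fun hne =>
    ⟨rfl, hops, by simp, hpre _ _ _ _ hdip hsip hdsn hhops hne.symm⟩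
  have hcov : Covers rt dip dsn (hops + 1) := update_covers hrt rfl
  refine ⟨⟨rfl, update_improves hrt h, h'⟩, ?_, ?_⟩
  · rintro _ ⟨-, rfl⟩
    exact ⟨contract_rel_self h' rfl rfl, wp_callAODV h'⟩
  rintro _ ⟨-, rfl⟩
  refine ⟨contract_rel_self h' rfl rfl, ?_, ?_⟩
  swap
  · rintro _ ⟨-, rfl⟩
    exact ⟨contract_rel_self h' rfl rfl, wp_callAODV h'⟩
  rintro _ ⟨-, rfl⟩
  refine ⟨contract_rel_self h' rfl rfl, ?_⟩
  rintro _ ⟨_, -, _, -, _, -, rt₁, hrt₁, rfl⟩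
  have h₁ := addpreRT_tableOK hrt₁ h'
  refine ⟨⟨rfl, addpreRT_improves hrt₁, h₁⟩, ?_⟩
  rintro _ ⟨_, -, _, -, _, -, _, -, rt₂, hrt₂, rfl⟩
  have h₂ := addpreRT_tableOK hrt₂ h₁
  refine ⟨⟨rfl, addpreRT_improves hrt₂, h₂⟩, ?_, wp_callAODV h₂, wp_linkBreak h₂⟩
  rintro _ ⟨_, hhops', _, hdip', _, hdsn', _, -, rfl⟩ -
  obtain rfl := Option.some.inj (hhops.symm.trans hhops')
  obtain rfl := Option.some.inj (hdip.symm.trans hdip')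
  obtain rfl := Option.some.inj (hdsn.symm.trans hdsn')
  -- The reply is sent after two precursor updates, through which coverage is transported.
  exact ⟨rfl, addpreRT_improves hrt₂ _ _ _ (addpreRT_improves hrt₁ _ _ _ hcov)⟩

theorem wp_Γ (w : World IP) (X : Name) (ξ : Val IP D) (hrel : (contract IP D).rel w ξ ξ)
    (hpre : (contract IP D).pre w X ξ) : (contract IP D).wp w (Γ X) ξ := by
  have h := hrel.2.2
  cases X with
  | aodv => exact ⟨wp_bodyAODVReceive h, wp_bodyAODVSend h, wp_bodyAODVRequest h⟩
  | newpkt => exact wp_bodyNEWPKT h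
  | pkt => exact wp_bodyPKT h
  | rreq => exact wp_bodyRREQ h hpre
  | rrep => exact wp_bodyRREP h hpre
  | rerr => exact wp_bodyRERR h

/-- The contract of the message queue: it sends only messages that satisfy `MsgOK`. -/
def queueContract (IP : Type u) (D : Type v) :
    AWN.Contract (Msg IP D) (QVal IP D) Unit (World IP) where
  rel _ _ _ := True
  pre w _ ζ := ∀ m ∈ ζ.msgs, MsgOK w m
  snd w _ m := MsgOK w m
  rcv w m := MsgOK w m

theorem queueContract_monotone : (queueContract IP D).Monotone where
  rel_mono _ _ _ _ := trivial
  pre_mono hw _ _ h m hm := (h m hm).mono hw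
  snd_mono hw _ _ h := h.mono hw
  rel_trans _ _ := trivial
  rel_refl _ := trivial

/-- Messages already queued stay correct because the world only grows. -/
theorem wp_queueReceive {w : World IP} {ζ : QVal IP D} (h : ∀ m ∈ ζ.msgs, MsgOK w m) :
    (queueContract IP D).wp w queueReceive ζ := by
  intro w' hw m hm
  refine ⟨trivial, ?_⟩
  rintro _ ⟨⟩
  refine ⟨trivial, fun _ _ _ h => h, fun m' hm' => ?_⟩
  rcases List.mem_append.1 hm' with hm' | hm'
  · exact (h m' hm').mono hw
  · exact List.mem_singleton.1 hm' ▸ hm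

theorem wp_bodyQMSG {w : World IP} {ζ : QVal IP D} (h : ∀ m ∈ ζ.msgs, MsgOK w m) :
    (queueContract IP D).wp w bodyQMSG ζ := by
  refine ⟨wp_queueReceive h, ?_⟩
  rintro _ ⟨-, rfl⟩
  refine ⟨trivial, ⟨fun m hm => h m (List.mem_of_mem_head? hm), ?_⟩, wp_queueReceive h⟩
  intro ζ' hζ'
  dsimp only at hζ'
  split_ifs at hζ'
  cases hζ'
  exact ⟨trivial, fun _ _ _ h => h, fun m hm => h m (List.mem_of_mem_tail hm)⟩

end Processes

end AODV

namespace AODV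

universe u v

/-! ### The invariant of nodes and networks -/

section Nodes

variable {IP : Type u} {D : Type v}

/-- The invariant of the process running on the node `a`, relative to the assertions `w`. -/
structure NodeOK (w : World IP) (a : IP) (s : NodeState IP D) : Prop where
  ip_eq : s.1.1.ip = a
  tableOK : TableOK w s.1.1.rt
  wp_process : (contract IP D).wp w s.1.2 s.1.1
  wp_queue : (queueContract IP D).wp w s.2.2 s.2.1

theorem NodeOK.mono {w w' : World IP} (hw : w ≤ w') {a : IP} {s : NodeState IP D}
    (h : NodeOK w a s) : NodeOK w' a s :=
  ⟨h.ip_eq, h.tableOK.mono hw, contract_monotone.wp_mono hw h.wp_process,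
    queueContract_monotone.wp_mono hw h.wp_queue⟩

/-- If the messages that arrive at a node are correct, then the invariant is preserved, the routing
table does not deteriorate, and the transmitted messages are correct. -/
theorem NodeOK.step {w : World IP} {a : IP} {s s' : NodeState IP D}
    {act : AWN.Act IP D (Msg IP D)} (h : NodeOK w a s) (hloc : s.1.1.world ≤ w)
    (hs : NodeStep s act s') (hrcv : ∀ m, act = .receive m → MsgOK w m) :
    NodeOK w a s' ∧ Improves s.1.1.rt s'.1.1.rt ∧ ∀ m, act.message = some m → MsgOK w m := by
  have hrel : (contract IP D).rel w s.1.1 s.1.1 := ⟨rfl, .refl _, h.tableOK⟩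
  have hQ : ∀ (X : Unit) ζ, (queueContract IP D).rel w ζ ζ → (queueContract IP D).pre w X ζ →
      (queueContract IP D).wp w bodyQMSG ζ := fun _ _ _ hpre => wp_bodyQMSG hpre
  cases hs with
  | left hs hne =>
    obtain ⟨h1, h2, h3⟩ := contract_monotone.seqStep (wp_Γ w) hs hrel h.wp_process
      fun m hm => absurd hm (hne m)
    -- The process guarantees its messages by its own table only; `hloc` lifts this to `w`.
    exact ⟨⟨h1.1.trans h.ip_eq, h1.2.2, h2, h.wp_queue⟩, h1.2.1, fun m hm => (h3 m hm).mono hloc⟩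
  | right hs hne =>
    obtain ⟨-, h2, h3⟩ := queueContract_monotone.seqStep hQ hs trivial h.wp_queue hrcv
    exact ⟨⟨h.ip_eq, h.tableOK, h.wp_process, h2⟩, .refl _, h3⟩
  | sync m hP hM =>
    obtain ⟨-, i2, i3⟩ := queueContract_monotone.seqStep hQ hM trivial h.wp_queue (by simp)
    obtain ⟨h1, h2, -⟩ := contract_monotone.seqStep (wp_Γ w) hP hrel h.wp_process
      (by rintro _ ⟨⟩; exact i3 m rfl)
    exact ⟨⟨h1.1.trans h.ip_eq, h1.2.2, h2, i2⟩, h1.2.1, by simp [AWN.Act.message]⟩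

theorem nodeOK_initState (w : World IP) (a : IP) : NodeOK w a (initState a : NodeState IP D) := by
  have h : TableOK w (initState a : NodeState IP D).1.1.rt := by rintro _ _ ⟨⟩
  refine ⟨rfl, h, wp_callAODV h, ?_⟩
  rintro _ ⟨⟩
  exact ⟨trivial, fun _ _ _ h => h, by rintro m ⟨⟩⟩

/-- The assertions that hold by the routing tables of all nodes of a network. -/
def networkWorld (N : Network IP D) : World IP := fun x dip n h =>
  ∀ s R, (x, s, R) ∈ N.nodes → Covers s.1.1.rt dip n h

/-- The invariant of AODV. -/
structure NetworkOK (N : Network IP D) : Prop where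
  nodup : (N.nodes.map Prod.fst).Nodup
  nodeOK : ∀ x ∈ N.nodes, NodeOK (networkWorld N) x.1 x.2.1

/-- Since addresses are distinct, the universal quantifier in `networkWorld` ranges over this one
node. For addresses outside the network it is vacuous, which is harmless as they have no outgoing
arcs. -/
theorem NetworkOK.world_le {N : Network IP D} (h : NetworkOK N) {x : IP × NodeState IP D × Set IP}
    (hx : x ∈ N.nodes) : x.2.1.1.1.world ≤ networkWorld N := by
  rintro y dip n k ⟨hy, hc⟩ s R hs
  rw [(h.nodeOK x hx).ip_eq] at hy
  have := List.inj_on_of_nodup_map h.nodup hs hx hy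
  rw [← this] at hc
  exact hc

theorem NetworkOK.of_initial {N : Network IP D} (h : Initial N) : NetworkOK N :=
  ⟨h.1, fun ⟨a, s, R⟩ hx => h.2 a s R hx ▸ nodeOK_initState _ _⟩

/-- All nodes are first moved within the old world; their tables improve, so the new world is larger
and the invariant transfers by monotonicity. -/
theorem NetworkOK.step {N N' : Network IP D} {l : AWN.ClosedAct IP D} (h : NetworkOK N)
    (hs : Step N l N') : NetworkOK N' := by
  -- The sender's own action is not a reception, so its guarantee rests on no assumption about
  -- arriving messages and there is no circularity.
  have hrcv : ∀ m : Msg IP D, ((∃ d dip, m = .newpkt d dip) ∨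
      ∃ x ∈ N.nodes, ∃ a s, NodeStep x.2.1 a s ∧ a.message = some m ∧ ∀ m', a ≠ .receive m') →
      MsgOK (networkWorld N) m := by
    rintro m (⟨d, dip, rfl⟩ | ⟨x, hx, a, s, hs, hm, hne⟩)
    · trivial
    · exact ((h.nodeOK x hx).step (h.world_le hx) hs fun m' hm' => absurd hm' (hne m')).2.2 m hm
  have hch := AWN.ClosedStep.forall₂ hs
  have hnode : List.Forall₂ (fun x y => x.1 = y.1 ∧ (x ∈ N.nodes →
      NodeOK (networkWorld N) y.1 y.2.1 ∧ Improves x.2.1.1.1.rt y.2.1.1.1.rt)) N.nodes N'.nodes := by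
    refine hch.imp ?_
    rintro x y ⟨hxy, hor⟩
    refine ⟨hxy, fun hx => hxy ▸ ?_⟩
    have hok := h.nodeOK x hx
    rcases hor with heq | ⟨a, ha, hm⟩
    · exact heq ▸ ⟨hok, .refl _⟩
    · obtain ⟨h1, h2, -⟩ := hok.step (h.world_le hx) ha fun m e => hrcv m (hm m e)
      exact ⟨h1, h2⟩
  have hmem : ∀ y ∈ N'.nodes, ∃ x ∈ N.nodes, x.1 = y.1 ∧ NodeOK (networkWorld N) y.1 y.2.1 ∧
      Improves x.2.1.1.1.rt y.2.1.1.1.rt := by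
    intro y hy
    obtain ⟨i, hi, rfl⟩ := List.mem_iff_getElem.1 hy
    have hi' : i < N.nodes.length := hnode.length_eq ▸ hi
    have := hnode.get hi' hi
    exact ⟨_, List.getElem_mem hi', this.1, this.2 (List.getElem_mem hi')⟩
  have hw : networkWorld N ≤ networkWorld N' := by
    intro x dip n k hc s R hs
    obtain ⟨⟨x', s', R'⟩, hx, hxy, -, himp⟩ := hmem _ hs
    obtain rfl : x' = x := hxy
    exact himp _ _ _ (hc _ _ hx)
  refine ⟨?_, fun y hy => ?_⟩
  · have : N.nodes.map Prod.fst = N'.nodes.map Prod.fst := by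
      rw [← List.forall₂_eq_eq_eq, List.forall₂_map_left_iff, List.forall₂_map_right_iff]
      exact hnode.imp fun _ _ h => h.1
    exact this ▸ h.nodup
  · obtain ⟨x, -, -, hok, -⟩ := hmem y hy
    exact hok.mono hw

theorem NetworkOK.of_reachable {N : Network IP D} (h : Reachable N) : NetworkOK N := by
  obtain ⟨N₀, h₀, h⟩ := h
  induction h with
  | refl => exact .of_initial h₀
  | tail _ hs ih => exact ih.step hs.choose_spec

/-! ### Routing graphs and absence of cycles -/

/-- Some node with address `a` has a valid entry for `dip ≠ a` with sequence number `n` and hop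
count `k`. -/
def HasRoute (N : Network IP D) (dip a : IP) (n k : ℕ) : Prop :=
  a ≠ dip ∧ ∃ s R, (a, s, R) ∈ N.nodes ∧
    ∃ e, s.1.1.rt dip = some e ∧ e.flag = .val ∧ e.dsn = n ∧ e.hops = k

theorem routingGraph_hasRoute {N : Network IP D} {dip a b : IP} (h : (routingGraph N dip).Adj a b) :
    ∃ n k, HasRoute N dip a n k := by
  obtain ⟨hne, ξ, p, Q, R, hmem, e, he, hv, -⟩ := h
  exact ⟨_, _, hne, _, _, hmem, e, he, hv, rfl, rfl⟩

theorem NetworkOK.hasRoute_unique {N : Network IP D} (h : NetworkOK N) {dip a : IP}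
    {n k n' k' : ℕ} (h₁ : HasRoute N dip a n k) (h₂ : HasRoute N dip a n' k') :
    n = n' ∧ k = k' := by
  obtain ⟨-, s, R, hs, e, he, -, rfl, rfl⟩ := h₁
  obtain ⟨-, s', R', hs', e', he', -, rfl, rfl⟩ := h₂
  cases List.inj_on_of_nodup_map h.nodup hs hs' rfl
  cases he.symm.trans he'
  exact ⟨rfl, rfl⟩

/-- Along the arcs of a routing graph, routes become strictly better. -/
theorem NetworkOK.route_lt {N : Network IP D} (h : NetworkOK N) {dip a b : IP} {n k n' k' : ℕ}
    (hab : (routingGraph N dip).Adj a b) (ha : HasRoute N dip a n k) (hb : HasRoute N dip b n' k') :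
    n < n' ∨ n = n' ∧ k' < k := by
  obtain ⟨hne, ξ, p, Q, R, hmem, e, he, hv, rfl⟩ := hab
  obtain ⟨rfl, rfl⟩ := h.hasRoute_unique ha ⟨hne, _, _, hmem, e, he, hv, rfl, rfl⟩
  obtain ⟨hne', s, R', hs, e', he', hv', rfl, rfl⟩ := hb
  -- As `b` has a route, `b ≠ dip`, so the invariant applies; uniqueness of addresses is not needed
  -- to evaluate the world at `b`.
  obtain ⟨j, hj, hw⟩ := ((h.nodeOK _ hmem).tableOK _ _ he).2.2 hv hne'
  obtain ⟨-, e'', he'', hc⟩ := hw _ _ hs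
  cases he'.symm.trans he''
  exact hc.imp_right fun hc => ⟨hc.1, hc.2.1.trans_lt hj⟩

theorem NetworkOK.loopFree {N : Network IP D} (h : NetworkOK N) : LoopFree N := by
  intro dip ip hcycle
  have key : ∀ a b, Relation.TransGen (routingGraph N dip).Adj a b → ∀ n k n' k',
      HasRoute N dip a n k → HasRoute N dip b n' k' → n < n' ∨ n = n' ∧ k' < k := by
    intro a b hab
    induction hab with
    | single hab => exact fun n k n' k' ha hb => h.route_lt hab ha hb
    | tail _ hbc ih =>
      intro n k n' k' ha hc
      -- The intermediate vertex has an outgoing arc, hence a route to compare with.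
      obtain ⟨n₁, k₁, hb⟩ := routingGraph_hasRoute hbc
      have h₁ := ih n k n₁ k₁ ha hb
      have h₂ := h.route_lt hbc hb hc
      omega
  obtain ⟨b, hb, -⟩ := Relation.TransGen.head'_iff.1 hcycle
  obtain ⟨n, k, hr⟩ := routingGraph_hasRoute hb
  have := key ip ip hcycle n k n k hr hr
  omega

end Nodes

end AODV

theorem mainTheorem1 {IP D : Type*} (N : AODV.Network IP D) (hN : AODV.Reachable N) :
    AODV.LoopFree N :=
  (AODV.NetworkOK.of_reachable hN).loopFree
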